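/- Let $T\subset\mathbb C$ be a logarithmic tract of a continuous function $f:\overline T\to\mathbb C$ with constant $R_0>0$: $T$ is an unbounded domain with unbounded complement, $|f|>R_0$ on $T$, $|f|=R_0$ on $\partial T$, and $f|_T$ is a holomorphic universal covering of $\{w:|w|>R_0\}$. (No regularity of $\partial T$ is required.) Assume $0\notin\overline T$. Put $H=\{z:\operatorname{Re} z>\ln R_0\}$. Let $L_0$ be a connected component of $\exp^{-1}(T)$, let $L_s=L_0+2\pi i s$ for $s\in\mathbb Z$ (the lifted tracts), and let $F:\bigcup_{s}L_s\to H$ be $f$ in logarithmic coordinates, i.e. a continuous $2\pi i$-periodic map with $\exp\circ F=f\circ\exp$. Then $F$ maps each $L_s$ bijectively onto $H$; let $F_s^{-1}:H\to L_s$ be the inverse branches. Moreover, there are arbitrarily large $R>0$ such that, with $Q=[\frac R2,\frac{3R}2]\times[-\frac R2,\frac R2]$ and $G=\{(u,s)\in\mathbb Z^2: F_u^{-1}(F_s^{-1}(Q))\subset Q\}$, the following holds. We have $Q\subset H$ and $F_s^{-1}(Q)\subset H$ for all $s$. The maps $F_u^{-1}\circ F_s^{-1}:Q\to Q$, $(u,s)\in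 G$, form a finite conformal iterated function system with at least two maps: each is injective and holomorphic on a neighbourhood of $Q$, they are uniformly strictly contracting on $Q$, and their images of $Q$ are pairwise disjoint. Let $J_B$ be its limit set, i.e. the intersection over $n\ge 0$ of the unions of the images of $Q$ under all $n$-fold compositions of these maps. Then: 1. $J_B$ is a (compact, non-empty, perfect, totally disconnected) Cantor set contained in $\bigcup_{s\in\mathbb Z}L_s$; 2. $\dim_H(J_B)>1$; 3. $F(J_B)\subset\bigcup_{s\in\mathbb Z}L_s$ and $F^2(J_B)=J_B$; in particular the forward trajectory of every point of $J_B$ under $F$ is well defined, stays in $\bigcup_s L_s$ and is bounded; 4. $|(F^n)'(z)|\to\infty$ as $n\to\infty$ for every $z\in J_B$. -/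

import Mathlib

open Set Filter

namespace LogTract

/-- `T` is a logarithmic tract of `f` with constant `R₀`: an unbounded domain with unbounded
complement, such that `f` is continuous on the closure of `T`, `|f| > R₀` on `T`, `|f| = R₀` on
`∂T`, and `f` is a holomorphic universal covering of `{w : |w| > R₀}` by `T`, that is, `T` is
simply connected and `f : T → {w : |w| > R₀}` is a holomorphic covering map.
No regularity of `∂T` (such as piecewise smoothness) is demanded, so that tracts with piecewise
smooth boundary are a special case. Only the values of `f` on the closure of `T` matter. -/
structure IsLogarithmicTract (f : ℂ → ℂ) (T : Set ℂ) (R₀ : ℝ) : Prop where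
  isOpen : IsOpen T
  isConnected : IsConnected T
  unbounded : ¬ Bornology.IsBounded T
  unbounded_compl : ¬ Bornology.IsBounded Tᶜ
  pos : 0 < R₀
  continuousOn : ContinuousOn f (closure T)
  mapsTo : MapsTo f T {w : ℂ | R₀ < ‖w‖}
  norm_eq : ∀ z ∈ frontier T, ‖f z‖ = R₀
  differentiableOn : DifferentiableOn ℂ f T
  simplyConnected : SimplyConnectedSpace T
  isCoveringMap : IsCoveringMap (mapsTo.restrict f T {w : ℂ | R₀ < ‖w‖})

/-- The half-plane `H = {z : Re z > ln R₀}`. -/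
def halfPlane (R₀ : ℝ) : Set ℂ := {z : ℂ | Real.log R₀ < z.re}

/-- `F` is `f` in logarithmic coordinates, with lifted tracts `L s` for `s ∈ ℤ`: the set `L 0` is
a connected component of `exp⁻¹ T`, `L s = L 0 + 2 π i s`, and `F` is a continuous,
`2 π i`-periodic lift of `f` by branches of the logarithm, `exp ∘ F = f ∘ exp`.
Only the values of `F` on the union of the `L s` matter. -/
structure IsLogCoordinates (f : ℂ → ℂ) (T : Set ℂ) (L : ℤ → Set ℂ) (F : ℂ → ℂ) : Prop where
  component : ∃ z ∈ Complex.exp ⁻¹' T, L 0 = connectedComponentIn (Complex.exp ⁻¹' T) z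
  translate : ∀ s : ℤ, L s = (fun z : ℂ => z + 2 * Real.pi * Complex.I * s) '' L 0
  continuousOn : ContinuousOn F (⋃ s, L s)
  exp_comp : ∀ z ∈ ⋃ s, L s, Complex.exp (F z) = f (Complex.exp z)
  periodic : ∀ z ∈ ⋃ s, L s, F (z + 2 * Real.pi * Complex.I) = F z

/-- The inverse branch `F_s⁻¹` of `F` with values in `L s` (meaningful on `F (L s)`). -/
noncomputable def invBranch (F : ℂ → ℂ) (L : ℤ → Set ℂ) (s : ℤ) : ℂ → ℂ :=
  Function.invFunOn F (L s)

/-- The map `F_u⁻¹ ∘ F_s⁻¹` for the pair `p = (u, s)`. -/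
noncomputable def invBranch₂ (F : ℂ → ℂ) (L : ℤ → Set ℂ) (p : ℤ × ℤ) : ℂ → ℂ :=
  invBranch F L p.1 ∘ invBranch F L p.2

/-- The closed square `[R/2, 3R/2] × [-R/2, R/2]`, with centre `R` and side `R`. -/
def square (R : ℝ) : Set ℂ := Icc (R / 2) (3 * R / 2) ×ℂ Icc (-(R / 2)) (R / 2)

/-- The pairs `(u, s)` with `F_u⁻¹ (F_s⁻¹ Q) ⊆ Q`, where `Q = square R`. -/
def goodPairs (F : ℂ → ℂ) (L : ℤ → Set ℂ) (R : ℝ) : Set (ℤ × ℤ) :=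
  {p | invBranch₂ F L p '' square R ⊆ square R}

/-- The maps `g i`, `i ∈ G`, form a finite conformal iterated function system on `Q` with pairwise
disjoint images: there are at least two of them, each is holomorphic and injective on a
neighbourhood of `Q` and maps `Q` into itself, they are uniformly strictly contracting on `Q`,
and the sets `g i (Q)` are pairwise disjoint. -/
structure IsConformalIFS {ι : Type*} (g : ι → ℂ → ℂ) (G : Set ι) (Q : Set ℂ) : Prop where
  finite : G.Finite
  nontrivial : G.Nontrivial
  conformal : ∀ i ∈ G, ∃ U : Set ℂ, IsOpen U ∧ Q ⊆ U ∧ DifferentiableOn ℂ (g i) U ∧ InjOn (g i) U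
  mapsTo : ∀ i ∈ G, MapsTo (g i) Q Q
  contracting : ∃ c : NNReal, c < 1 ∧ ∀ i ∈ G, LipschitzOnWith c (g i) Q
  disjoint : G.PairwiseDisjoint (fun i => g i '' Q)

/-- The limit set of the system `g i`, `i ∈ G`, on `Q`: the intersection over `n` of the unions
of the sets `g_{i₁} ∘ ⋯ ∘ g_{iₙ} (Q)` over all words `i₁ … iₙ` in `G`. -/
def limitSet {ι : Type*} (g : ι → ℂ → ℂ) (G : Set ι) (Q : Set ℂ) : Set ℂ :=
  ⋂ n : ℕ, (fun K : Set ℂ => ⋃ i ∈ G, g i '' K)^[n] Q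

/-- A Cantor set: non-empty, compact, perfect and totally disconnected. -/
structure IsCantorSet (J : Set ℂ) : Prop where
  nonempty : J.Nonempty
  isCompact : IsCompact J
  perfect : Perfect J
  totallyDisconnected : IsTotallyDisconnected J

end LogTract

/-! Let `g` be the inverse branch of `F` on the half-plane with values in `L 0`. The other branches
are its vertical translates, so `F_u⁻¹ ∘ F_s⁻¹` is `x ↦ g (g x + 2πis) + 2πiu`. No two points of `L
0` differ by `2πi`, so the image of `g` contains no disc of radius larger than `π`, and a weak Bloch
theorem gives `|g'(w)| ≤ 384 / (Re w - log R₀)` (`IsTractBranch.mul_norm_deriv_le`). Hence `g` maps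
the square `Q` to a set of bounded diameter, and since `Re g(R)` is large, the second application of
`g` shrinks this set to size less than one. A pair `(u, s)` is therefore good as soon as the image
of the centre `R` lies in `Q` with margin one.

The dimension bound comes from adding up contraction factors. Put `p_s = g(R) + 2πis`. By Koebe-type
distortion the map of the pair `(u, s)` has lower Lipschitz constant at least a constant times
`|g'(R)| |g'(p_s)|`. As `s` grows from `0`, `Re g(p_s)` climbs from below `R/2` to above `3R/2`,
with jumps bounded by a multiple of `|g'(p_s)|`; so the sum of `|g'(p_s)|` over those `s` that land
in the right range is at least a constant times `R`. Each such `s` admits at least `R/10` values of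
`u`. The factors thus add up to at least a constant times `R² |g'(R)|`. This quantity is unbounded
as `R → ∞`, for otherwise `g'` would be integrable along the real axis and `Re g` could not tend to
infinity there. A finite system with disjoint images whose lower Lipschitz constants sum to more
than one has a limit set of dimension greater than one (`IsConformalIFS.one_lt_dimH_limitSet`).

The boundary of the tract enters only through compactness: `f` is bounded on bounded parts of
`closure T`, and level sets `|f| = e^a` with `a > log R₀` stay away from the boundary. This yields
`Re g → ∞` both to the right and along vertical lines. -/

namespace LogTract

open Topology MeasureTheory Metric
open scoped ENNReal NNReal

/-! ### Limit sets of iterated function systems: topology and dimension -/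

section IFS

variable {ι : Type*} {g : ι → ℂ → ℂ} {G : Set ι} {Q : Set ℂ}

theorem IsConformalIFS.continuousOn (h : IsConformalIFS g G Q) {i : ι} (hi : i ∈ G) :
    ContinuousOn (g i) Q := by
  obtain ⟨c, -, hc⟩ := h.contracting
  exact (hc i hi).continuousOn

theorem IsConformalIFS.injOn (h : IsConformalIFS g G Q) {i : ι} (hi : i ∈ G) : InjOn (g i) Q := by
  obtain ⟨U, -, hQ, -, hU⟩ := h.conformal i hi
  exact hU.mono hQ

theorem IsConformalIFS.iterate_succ_subset (h : IsConformalIFS g G Q) (n : ℕ) :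
    (fun K : Set ℂ => ⋃ i ∈ G, g i '' K)^[n + 1] Q ⊆
      (fun K : Set ℂ => ⋃ i ∈ G, g i '' K)^[n] Q := by
  induction n with
  | zero =>
    simp only [zero_add, Function.iterate_one, Function.iterate_zero, id_eq, iUnion_subset_iff]
    exact fun i hi => (h.mapsTo i hi).image_subset
  | succ n ih =>
    rw [Function.iterate_succ_apply' _ (n + 1)]
    refine Subset.trans ?_ (Function.iterate_succ_apply' (fun K : Set ℂ => ⋃ i ∈ G, g i '' K) n Q).ge
    exact iUnion₂_mono fun i _ => image_mono ih

theorem IsConformalIFS.iterate_subset (h : IsConformalIFS g G Q) (n : ℕ) :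
    (fun K : Set ℂ => ⋃ i ∈ G, g i '' K)^[n] Q ⊆ Q := by
  induction n with
  | zero => simp
  | succ n ih => exact (h.iterate_succ_subset n).trans ih

theorem IsConformalIFS.isCompact_iterate (h : IsConformalIFS g G Q) (hQ : IsCompact Q) (n : ℕ) :
    IsCompact ((fun K : Set ℂ => ⋃ i ∈ G, g i '' K)^[n] Q) := by
  induction n with
  | zero => simpa
  | succ n ih =>
    rw [Function.iterate_succ_apply']
    exact h.finite.isCompact_biUnion fun i hi =>
      ih.image_of_continuousOn ((h.continuousOn hi).mono (h.iterate_subset n))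

theorem IsConformalIFS.nonempty_iterate (h : IsConformalIFS g G Q) (hQ : Q.Nonempty) (n : ℕ) :
    ((fun K : Set ℂ => ⋃ i ∈ G, g i '' K)^[n] Q).Nonempty := by
  induction n with
  | zero => simpa
  | succ n ih =>
    rw [Function.iterate_succ_apply']
    obtain ⟨i, hi⟩ := h.nontrivial.nonempty
    exact (ih.image (g i)).mono (subset_biUnion_of_mem (u := fun i => g i '' _) hi)

theorem limitSet_subset : limitSet g G Q ⊆ Q :=
  fun _ hx => mem_iInter.1 hx 0

theorem IsConformalIFS.isCompact_limitSet (h : IsConformalIFS g G Q) (hQ : IsCompact Q) :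
    IsCompact (limitSet g G Q) :=
  hQ.of_isClosed_subset (isClosed_iInter fun n => (h.isCompact_iterate hQ n).isClosed)
    limitSet_subset

theorem IsConformalIFS.nonempty_limitSet (h : IsConformalIFS g G Q) (hQ : IsCompact Q)
    (hne : Q.Nonempty) : (limitSet g G Q).Nonempty :=
  IsCompact.nonempty_iInter_of_sequence_nonempty_isCompact_isClosed _ h.iterate_succ_subset
    (h.nonempty_iterate hne) (h.isCompact_iterate hQ 0)
    fun n => (h.isCompact_iterate hQ n).isClosed

theorem IsConformalIFS.biUnion_image_limitSet (h : IsConformalIFS g G Q) :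
    ⋃ i ∈ G, g i '' limitSet g G Q = limitSet g G Q := by
  apply Subset.antisymm
  · refine iUnion₂_subset fun i hi => ?_
    rintro _ ⟨x, hx, rfl⟩
    refine mem_iInter.2 fun n => h.iterate_succ_subset n ?_
    rw [Function.iterate_succ_apply']
    exact mem_biUnion hi ⟨x, mem_iInter.1 hx n, rfl⟩
  · intro x hx
    have key : ∀ n, ∃ i ∈ G, ∃ y ∈ (fun K : Set ℂ => ⋃ i ∈ G, g i '' K)^[n] Q, g i y = x := by
      intro n
      have := mem_iInter.1 hx (n + 1)
      rw [Function.iterate_succ_apply'] at this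
      simpa using this
    -- Disjointness of the images fixes the index, and injectivity then fixes the preimage, so the
    -- preimage found at level `0` works at every level.
    obtain ⟨i, hi, y, hy, rfl⟩ := key 0
    refine mem_biUnion hi ⟨y, mem_iInter.2 fun n => ?_, rfl⟩
    obtain ⟨j, hj, z, hz, hzy⟩ := key n
    have hzQ := h.iterate_subset n hz
    have hyQ : y ∈ Q := hy
    obtain rfl : j = i := h.disjoint.elim_set hj hi _ ⟨z, hzQ, hzy⟩ ⟨y, hyQ, rfl⟩
    rwa [h.injOn hi hzQ hyQ hzy] at hz

theorem IsConformalIFS.exists_ne_limitSet (h : IsConformalIFS g G Q) (hQ : IsCompact Q)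
    (hne : Q.Nonempty) : ∃ x ∈ limitSet g G Q, ∃ y ∈ limitSet g G Q, x ≠ y := by
  obtain ⟨z, hz⟩ := h.nonempty_limitSet hQ hne
  obtain ⟨i, hi, j, hj, hij⟩ := h.nontrivial
  have hmem : ∀ k ∈ G, g k z ∈ limitSet g G Q := fun k hk => by
    rw [← h.biUnion_image_limitSet]
    exact mem_biUnion hk ⟨z, hz, rfl⟩
  refine ⟨g i z, hmem i hi, g j z, hmem j hj, fun e => hij ?_⟩
  have hzQ := limitSet_subset hz
  exact h.disjoint.elim_set hi hj _ ⟨z, hzQ, rfl⟩ ⟨z, hzQ, e.symm⟩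

/-- Pulling back `n` times reduces to finding a second point of the limit set somewhere in it;
pushing forward brings that point within `c ^ n * diam J`. -/
theorem IsConformalIFS.perfect_limitSet (h : IsConformalIFS g G Q) (hQ : IsCompact Q)
    (hne : Q.Nonempty) : Perfect (limitSet g G Q) := by
  refine ⟨(h.isCompact_limitSet hQ).isClosed, ?_⟩
  obtain ⟨c, hc1, hc⟩ := h.contracting
  set J := limitSet g G Q with hJ
  have key : ∀ n : ℕ, ∀ x ∈ J, ∃ y ∈ J, y ≠ x ∧ dist x y ≤ c ^ n * diam J := by
    intro n
    induction n with
    | zero =>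
      intro x hx
      obtain ⟨a, ha, b, hb, hab⟩ := h.exists_ne_limitSet hQ hne
      have hbd := (h.isCompact_limitSet hQ).isBounded
      by_cases hxa : a = x
      · exact ⟨b, hb, fun e => hab (hxa.trans e.symm), by
          simpa using dist_le_diam_of_mem hbd hx hb⟩
      · exact ⟨a, ha, hxa, by simpa using dist_le_diam_of_mem hbd hx ha⟩
    | succ n ih =>
      intro x hx
      rw [hJ, ← h.biUnion_image_limitSet] at hx
      obtain ⟨i, hi, x, hx', rfl⟩ := mem_iUnion₂.1 hx
      replace hx := hx'
      obtain ⟨y, hy, hyx, hd⟩ := ih x hx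
      refine ⟨g i y, ?_, fun e => hyx (h.injOn hi (limitSet_subset hy) (limitSet_subset hx) e), ?_⟩
      · rw [hJ, ← h.biUnion_image_limitSet]
        exact mem_biUnion hi ⟨y, hy, rfl⟩
      · calc dist (g i x) (g i y) ≤ c * dist x y :=
              (hc i hi).dist_le_mul _ (limitSet_subset hx) _ (limitSet_subset hy)
          _ ≤ c * (c ^ n * diam J) := by gcongr
          _ = c ^ (n + 1) * diam J := by ring
  intro x hx
  rw [accPt_iff_nhds]
  intro U hU
  obtain ⟨ε, hε, hb⟩ := Metric.mem_nhds_iff.1 hU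
  have hlim : Tendsto (fun n : ℕ => (c : ℝ) ^ n * diam J) atTop (𝓝 (0 * diam J)) :=
    (tendsto_pow_atTop_nhds_zero_of_lt_one c.2 hc1).mul_const _
  rw [zero_mul] at hlim
  obtain ⟨n, hn⟩ := (hlim.eventually_lt_const hε).exists
  obtain ⟨y, hy, hyx, hd⟩ := key n x hx
  exact ⟨y, ⟨hb (by rw [mem_ball, dist_comm]; exact hd.trans_lt hn), hy⟩, hyx⟩

/-- A connected subset lies in a single piece `g i '' J`, since the pieces are disjoint and compact.
Its preimage is again connected because `g i` embeds the compact set `J`, so iterating bounds its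
diameter by `c ^ n * diam J`. -/
theorem IsConformalIFS.isTotallyDisconnected_limitSet (h : IsConformalIFS g G Q)
    (hQ : IsCompact Q) : IsTotallyDisconnected (limitSet g G Q) := by
  obtain ⟨c, hc1, hc⟩ := h.contracting
  set J := limitSet g G Q with hJ
  have hJc : IsCompact J := h.isCompact_limitSet hQ
  have hclosed : ∀ i ∈ G, IsCompact (g i '' J) := fun i hi =>
    hJc.image_of_continuousOn ((h.continuousOn hi).mono limitSet_subset)
  have key : ∀ n : ℕ, ∀ C ⊆ J, IsPreconnected C → ∀ x ∈ C, ∀ y ∈ C,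
      dist x y ≤ c ^ n * diam J := by
    intro n
    induction n with
    | zero =>
      intro C hC _ x hx y hy
      simpa using dist_le_diam_of_mem hJc.isBounded (hC hx) (hC hy)
    | succ n ih =>
      intro C hC hCp x hx y hy
      have hxJ := hC hx
      rw [hJ, ← h.biUnion_image_limitSet] at hxJ
      obtain ⟨i, hi, x, hxJ', rfl⟩ := mem_iUnion₂.1 hxJ
      replace hxJ := hxJ'
      have hsub : C ⊆ g i '' J := by
        have hcov : C ⊆ g i '' J ∪ ⋃ j ∈ G \ {i}, g j '' J := by
          intro z hz
          have hzJ := hC hz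
          rw [hJ, ← h.biUnion_image_limitSet] at hzJ
          obtain ⟨j, hj, hzj⟩ := mem_iUnion₂.1 hzJ
          by_cases hji : j = i
          · exact Or.inl (hji ▸ hzj)
          · exact Or.inr (mem_biUnion ⟨hj, hji⟩ hzj)
        have hd : Disjoint (g i '' J) (⋃ j ∈ G \ {i}, g j '' J) := by
          refine disjoint_iUnion₂_right.2 fun j hj => ?_
          exact (h.disjoint hi hj.1 (Ne.symm hj.2)).mono (image_mono limitSet_subset)
            (image_mono limitSet_subset)
        refine (isPreconnected_iff_subset_of_disjoint_closed.1 hCp _ _ (hclosed i hi).isClosed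
          (h.finite.sdiff.isClosed_biUnion fun j hj => (hclosed j hj.1).isClosed) hcov
          (by rw [hd.inter_eq, inter_empty])).resolve_right fun hr => ?_
        exact disjoint_left.1 hd (mem_image_of_mem _ hxJ) (hr hx)
      set D : Set J := {z | g i z ∈ C} with hD
      have hind : IsInducing (fun z : J => g i z) := by
        have hcont : Continuous (fun z : J => g i z) :=
          continuousOn_iff_continuous_domRestrict.1 ((h.continuousOn hi).mono limitSet_subset)
        have : CompactSpace J := isCompact_iff_compactSpace.1 hJc
        exact (hcont.isClosedEmbedding fun a b hab => Subtype.ext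
          (h.injOn hi (limitSet_subset a.2) (limitSet_subset b.2) hab)).isInducing
      have himg : (fun z : J => g i z) '' D = C := by
        ext z
        constructor
        · rintro ⟨w, hw, rfl⟩
          exact hw
        · intro hz
          obtain ⟨w, hw, rfl⟩ := hsub hz
          exact ⟨⟨w, hw⟩, hz, rfl⟩
      have hDp : IsPreconnected D := by
        rw [← hind.isPreconnected_image, himg]
        exact hCp
      obtain ⟨y, hyJ, rfl⟩ := hsub hy
      have := ih (Subtype.val '' D) (by rintro _ ⟨w, -, rfl⟩; exact w.2)
        (hDp.image _ continuous_subtype_val.continuousOn) x ⟨⟨x, hxJ⟩, hx, rfl⟩ y ⟨⟨y, hyJ⟩, hy, rfl⟩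
      calc dist (g i x) (g i y) ≤ c * dist x y :=
              (hc i hi).dist_le_mul _ (limitSet_subset hxJ) _ (limitSet_subset hyJ)
          _ ≤ c * (c ^ n * diam J) := by gcongr
          _ = c ^ (n + 1) * diam J := by ring
  intro C hC hCp x hx y hy
  have hlim : Tendsto (fun n : ℕ => (c : ℝ) ^ n * diam J) atTop (𝓝 (0 * diam J)) :=
    (tendsto_pow_atTop_nhds_zero_of_lt_one c.2 hc1).mul_const _
  rw [zero_mul] at hlim
  exact dist_le_zero.1 (ge_of_tendsto' hlim fun n => key n C hC hCp x hx y hy)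

theorem IsConformalIFS.isCantorSet_limitSet (h : IsConformalIFS g G Q) (hQ : IsCompact Q)
    (hne : Q.Nonempty) : IsCantorSet (limitSet g G Q) :=
  ⟨h.nonempty_limitSet hQ hne, h.isCompact_limitSet hQ, h.perfect_limitSet hQ hne,
    h.isTotallyDisconnected_limitSet hQ⟩

/-- Induction on the finite cover. A cover set meeting two different pieces already has diameter at
least `δ`. Otherwise the cover splits into disjoint subfamilies, one for each piece; pulling each
back by `g i` divides diameters by `c i`, and the induction hypotheses add up with weights `c i ^ s`
of total at least one. -/
theorem rpow_le_sum_of_subset_biUnion {J : Set ℂ} (hJ : J = ⋃ i ∈ G, g i '' J)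
    (hne : J.Nonempty) (hG : G.Finite) (hGn : G.Nontrivial) {c : ι → ℝ} (hc : ∀ i ∈ G, 0 < c i)
    (hlow : ∀ i ∈ G, ∀ x ∈ J, ∀ y ∈ J, c i * dist x y ≤ dist (g i x) (g i y))
    {δ : ℝ} (hδ : 0 < δ)
    (hsep : ∀ i ∈ G, ∀ j ∈ G, i ≠ j → ∀ x ∈ J, ∀ y ∈ J, δ ≤ dist (g i x) (g j y))
    {s : ℝ} (hs : 0 < s) (hsum : 1 ≤ ∑ i ∈ hG.toFinset, c i ^ s) {κ : Type*} (t : Finset κ) :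
    ∀ (U : κ → Set ℂ) (d : κ → ℝ), (∀ k ∈ t, 0 ≤ d k) →
      (∀ k ∈ t, ∀ x ∈ U k, ∀ y ∈ U k, dist x y ≤ d k) → J ⊆ ⋃ k ∈ t, U k →
      δ ^ s ≤ ∑ k ∈ t, d k ^ s := by
  classical
  induction t using Finset.strongInduction with
  | H t ih =>
  intro U d hd hU hcov
  by_cases hmeet : ∃ k ∈ t, ∃ i ∈ G, ∃ j ∈ G, i ≠ j ∧ (∃ x ∈ J, g i x ∈ U k) ∧
      ∃ y ∈ J, g j y ∈ U k
  · obtain ⟨k, hk, i, hi, j, hj, hij, ⟨x, hx, hxk⟩, ⟨y, hy, hyk⟩⟩ := hmeet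
    calc δ ^ s ≤ d k ^ s :=
          Real.rpow_le_rpow hδ.le ((hsep i hi j hj hij x hx y hy).trans (hU k hk _ hxk _ hyk)) hs.le
      _ ≤ ∑ k ∈ t, d k ^ s :=
          Finset.single_le_sum (f := fun k => d k ^ s)
            (fun k hk => Real.rpow_nonneg (hd k hk) s) hk
  · push Not at hmeet
    set t' : ι → Finset κ := fun i => t.filter fun k => ∃ x ∈ J, g i x ∈ U k with ht'
    have hgJ : ∀ i ∈ G, ∀ x ∈ J, ∃ k ∈ t' i, g i x ∈ U k := by
      intro i hi x hx
      have : g i x ∈ J := by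
        rw [hJ]
        exact mem_biUnion hi ⟨x, hx, rfl⟩
      obtain ⟨k, hk, hxk⟩ := mem_iUnion₂.1 (hcov this)
      exact ⟨k, Finset.mem_filter.2 ⟨hk, x, hx, hxk⟩, hxk⟩
    have hdisj : ∀ i ∈ G, ∀ j ∈ G, i ≠ j → Disjoint (t' i) (t' j) := by
      intro i hi j hj hij
      refine Finset.disjoint_left.2 fun k hki hkj => ?_
      obtain ⟨hk, hx⟩ := Finset.mem_filter.1 hki
      obtain ⟨y, hy, hyk⟩ := (Finset.mem_filter.1 hkj).2
      exact hmeet k hk i hi j hj hij hx y hy hyk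
    have hone : ∀ i ∈ G, c i ^ s * δ ^ s ≤ ∑ k ∈ t' i, d k ^ s := by
      intro i hi
      -- The inclusion is strict because some other piece also needs at least one cover set.
      have hss : t' i ⊂ t := by
        refine (Finset.filter_subset _ _).ssubset_of_ne fun e => ?_
        obtain ⟨j, hj, hji⟩ := hGn.exists_ne i
        obtain ⟨x, hx⟩ := hne
        obtain ⟨k, hk, -⟩ := hgJ j hj x hx
        exact Finset.disjoint_left.1 (hdisj j hj i hi hji) hk
          ((show t' i = t from e).symm ▸ Finset.filter_subset _ _ hk)
      have := ih (t' i) hss (fun k => {x | x ∈ J ∧ g i x ∈ U k}) (fun k => d k / c i)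
        (fun k hk => div_nonneg (hd k (hss.1 hk)) (hc i hi).le)
        (fun k hk x hx y hy => by
          rw [le_div_iff₀ (hc i hi), mul_comm]
          exact (hlow i hi x hx.1 y hy.1).trans (hU k (hss.1 hk) _ hx.2 _ hy.2))
        (fun x hx => by
          obtain ⟨k, hk, hxk⟩ := hgJ i hi x hx
          exact mem_biUnion (x := k) hk ⟨hx, hxk⟩)
      have hrw : ∑ k ∈ t' i, (d k / c i) ^ s = (∑ k ∈ t' i, d k ^ s) / c i ^ s := by
        rw [Finset.sum_div]
        exact Finset.sum_congr rfl fun k hk => Real.div_rpow (hd k (hss.1 hk)) (hc i hi).le s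
      rw [hrw, le_div_iff₀ (Real.rpow_pos_of_pos (hc i hi) s)] at this
      linarith
    calc δ ^ s ≤ (∑ i ∈ hG.toFinset, c i ^ s) * δ ^ s :=
          le_mul_of_one_le_left (Real.rpow_nonneg hδ.le s) hsum
      _ = ∑ i ∈ hG.toFinset, c i ^ s * δ ^ s := Finset.sum_mul _ _ _
      _ ≤ ∑ i ∈ hG.toFinset, ∑ k ∈ t' i, d k ^ s :=
          Finset.sum_le_sum fun i hi => hone i (hG.mem_toFinset.1 hi)
      _ = ∑ k ∈ hG.toFinset.biUnion t', d k ^ s := by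
          rw [Finset.sum_biUnion]
          exact fun i hi j hj hij => hdisj i (hG.mem_toFinset.1 hi) j (hG.mem_toFinset.1 hj) hij
      _ ≤ ∑ k ∈ t, d k ^ s := by
          refine Finset.sum_le_sum_of_subset_of_nonneg
            (Finset.biUnion_subset.2 fun i _ => Finset.filter_subset _ _)
            fun k hk _ => Real.rpow_nonneg (hd k hk) s

/-- A lower bound for sums over finite covers bounds the Hausdorff measure of a compact set. -/
theorem ofReal_le_hausdorffMeasure {J : Set ℂ} (hJ : IsCompact J) {s : ℝ} (hs : 0 < s) {m : ℝ}
    (h : ∀ (t : Finset ℕ) (U : ℕ → Set ℂ) (d : ℕ → ℝ), (∀ k ∈ t, 0 ≤ d k) →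
      (∀ k ∈ t, ∀ x ∈ U k, ∀ y ∈ U k, dist x y ≤ d k) → J ⊆ ⋃ k ∈ t, U k →
      m ≤ ∑ k ∈ t, d k ^ s) :
    ENNReal.ofReal m ≤ μH[s] J := by
  classical
  rw [Measure.hausdorffMeasure_apply]
  -- Any finite scale would do: the bound on diameters serves only to make them finite.
  refine le_iSup₂_of_le 1 one_pos ?_
  refine le_iInf fun t => le_iInf fun hcov => le_iInf fun hdiam => ?_
  refine ENNReal.le_of_forall_pos_le_add fun ε hε _ => ?_
  obtain ⟨ε', hε', hsum⟩ := ENNReal.exists_pos_sum_of_countable (ENNReal.coe_pos.2 hε).ne' ℕ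
  set e : ℕ → ℝ := fun n => (ediam (t n)).toReal with he
  have hfin : ∀ n, ediam (t n) ≠ ⊤ := fun n => ((hdiam n).trans_lt ENNReal.one_lt_top).ne
  -- Each set is fattened to an open one at a cost `ε' n` in its term, so that compactness extracts
  -- a finite subcover.
  have hη : ∀ n, ∃ η : ℝ, 0 < η ∧ (e n + 2 * η) ^ s ≤ e n ^ s + ε' n := by
    intro n
    have hcont : ContinuousAt (fun η : ℝ => (e n + 2 * η) ^ s) 0 :=
      (by fun_prop : ContinuousAt (fun η : ℝ => e n + 2 * η) 0).rpow_const (Or.inr hs.le)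
    have hlt : (e n + 2 * 0) ^ s < e n ^ s + ε' n := by
      simpa using hε' n
    have hev := hcont.eventually (Iio_mem_nhds hlt)
    obtain ⟨η, hη, hpos⟩ := ((hev.filter_mono nhdsWithin_le_nhds).and
      (self_mem_nhdsWithin : Ioi (0 : ℝ) ∈ 𝓝[>] 0)).exists
    exact ⟨η, hpos, le_of_lt hη⟩
  choose η hη0 hη using hη
  have hcov' : J ⊆ ⋃ n, thickening (η n) (t n) :=
    hcov.trans (iUnion_mono fun n => self_subset_thickening (hη0 n) _)
  obtain ⟨b, hb⟩ := hJ.elim_finite_subcover _ (fun n => isOpen_thickening) hcov'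
  set b' := b.filter fun n => (t n).Nonempty with hb'
  have hcb : J ⊆ ⋃ n ∈ b', thickening (η n) (t n) := by
    intro x hx
    obtain ⟨n, hn, hxn⟩ := mem_iUnion₂.1 (hb hx)
    refine mem_biUnion (Finset.mem_filter.2 ⟨hn, ?_⟩) hxn
    by_contra hemp
    rw [not_nonempty_iff_eq_empty] at hemp
    simp [hemp] at hxn
  have hm := h b' (fun n => thickening (η n) (t n)) (fun n => e n + 2 * η n)
    (fun n _ => add_nonneg ENNReal.toReal_nonneg (by linarith [hη0 n]))
    (fun n _ x hx y hy => by
      obtain ⟨x', hx', hxx⟩ := mem_thickening_iff.1 hx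
      obtain ⟨y', hy', hyy⟩ := mem_thickening_iff.1 hy
      have h1 : dist x' y' ≤ e n := by
        rw [dist_edist]
        exact ENNReal.toReal_mono (hfin n) (edist_le_ediam_of_mem hx' hy')
      have h2 := dist_triangle4_right x y x' y'
      linarith) hcb
  calc ENNReal.ofReal m ≤ ENNReal.ofReal (∑ n ∈ b', (e n ^ s + ε' n)) :=
        ENNReal.ofReal_le_ofReal (hm.trans (Finset.sum_le_sum fun n _ => hη n))
    _ = ∑ n ∈ b', ENNReal.ofReal (e n ^ s + ε' n) :=
        ENNReal.ofReal_sum_of_nonneg fun n _ =>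
          add_nonneg (Real.rpow_nonneg ENNReal.toReal_nonneg _) (ε' n).2
    _ = ∑ n ∈ b', (ediam (t n) ^ s + ε' n) := by
        refine Finset.sum_congr rfl fun n _ => ?_
        simp only [he]
        rw [ENNReal.ofReal_add (Real.rpow_nonneg ENNReal.toReal_nonneg _) (ε' n).coe_nonneg,
          ENNReal.ofReal_coe_nnreal, ← ENNReal.ofReal_rpow_of_nonneg ENNReal.toReal_nonneg hs.le,
          ENNReal.ofReal_toReal (hfin n)]
    _ = ∑ n ∈ b', ediam (t n) ^ s + ∑ n ∈ b', (ε' n : ℝ≥0∞) := Finset.sum_add_distrib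
    _ ≤ ∑' n, (⨆ _ : (t n).Nonempty, ediam (t n) ^ s) + ε := by
        gcongr
        · refine le_trans (Finset.sum_le_sum fun n hn => ?_) (ENNReal.sum_le_tsum b')
          exact le_iSup_of_le (Finset.mem_filter.1 hn).2 le_rfl
        · exact (ENNReal.sum_le_tsum b').trans hsum.le

theorem IsConformalIFS.one_lt_dimH_limitSet (h : IsConformalIFS g G Q) (hQ : IsCompact Q)
    (hne : Q.Nonempty) {c : ι → ℝ} (hc : ∀ i ∈ G, 0 < c i)
    (hlow : ∀ i ∈ G, ∀ x ∈ Q, ∀ y ∈ Q, c i * dist x y ≤ dist (g i x) (g i y))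
    (hsum : 1 < ∑ i ∈ h.finite.toFinset, c i) : 1 < dimH (limitSet g G Q) := by
  set J := limitSet g G Q with hJ
  have hJc : IsCompact J := h.isCompact_limitSet hQ
  have hcpt : ∀ i ∈ G, IsCompact (g i '' J) := fun i hi =>
    hJc.image_of_continuousOn ((h.continuousOn hi).mono limitSet_subset)
  -- The strict inequality at exponent `1` survives at a slightly larger exponent.
  obtain ⟨s, hs1, hs⟩ : ∃ s : ℝ, 1 < s ∧ 1 ≤ ∑ i ∈ h.finite.toFinset, c i ^ s := by
    have hcont : ContinuousAt (fun s : ℝ => ∑ i ∈ h.finite.toFinset, c i ^ s) 1 := by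
      refine tendsto_finsetSum _ fun i hi => ?_
      exact (Real.continuous_const_rpow (hc i (h.finite.mem_toFinset.1 hi)).ne').continuousAt
    have hlt : 1 < ∑ i ∈ h.finite.toFinset, c i ^ (1 : ℝ) := by simpa using hsum
    obtain ⟨s, hs, hpos⟩ := (((hcont.eventually (Ioi_mem_nhds hlt)).filter_mono
      nhdsWithin_le_nhds).and (self_mem_nhdsWithin : Ioi (1 : ℝ) ∈ 𝓝[>] 1)).exists
    exact ⟨s, hpos, le_of_lt hs⟩
  have hpair : ∀ i ∈ G, ∀ j ∈ G, ∃ δ : ℝ, 0 < δ ∧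
      (i ≠ j → ∀ x ∈ J, ∀ y ∈ J, δ ≤ dist (g i x) (g j y)) := by
    intro i hi j hj
    by_cases hij : i = j
    · exact ⟨1, one_pos, fun hne => absurd hij hne⟩
    obtain ⟨r, hr, hd⟩ := exists_pos_forall_lt_edist (hcpt i hi) (hcpt j hj).isClosed
      ((h.disjoint hi hj hij).mono (image_mono limitSet_subset) (image_mono limitSet_subset))
    refine ⟨r, hr, fun _ x hx y hy => ?_⟩
    have := hd _ (mem_image_of_mem _ hx) _ (mem_image_of_mem _ hy)
    rw [edist_nndist, ENNReal.coe_lt_coe] at this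
    exact_mod_cast this.le
  obtain ⟨δ, hδ, hsep⟩ : ∃ δ : ℝ, 0 < δ ∧
      ∀ i ∈ G, ∀ j ∈ G, i ≠ j → ∀ x ∈ J, ∀ y ∈ J, δ ≤ dist (g i x) (g j y) := by
    choose! δ hδ hsep using hpair
    classical
    have hGG : ((h.finite.toFinset ×ˢ h.finite.toFinset).image fun p => δ p.1 p.2).Nonempty := by
      obtain ⟨i, hi⟩ := h.nontrivial.nonempty
      exact ⟨δ i i, Finset.mem_image.2 ⟨(i, i), by simp [hi], rfl⟩⟩
    refine ⟨Finset.min' _ hGG, ?_, fun i hi j hj hij x hx y hy =>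
      (Finset.min'_le _ _ ?_).trans (hsep i hi j hj hij x hx y hy)⟩
    · rw [Finset.lt_min'_iff]
      simp only [Finset.mem_image, Prod.exists, Finset.mem_product, Finite.mem_toFinset]
      rintro _ ⟨i, j, ⟨hi, hj⟩, rfl⟩
      exact hδ i hi j hj
    · exact Finset.mem_image.2 ⟨(i, j), by simp [hi, hj], rfl⟩
  have hs0 : 0 < s := one_pos.trans hs1
  have hmeas : ENNReal.ofReal (δ ^ s) ≤ μH[s] J :=
    ofReal_le_hausdorffMeasure hJc hs0 fun t U d hd hU hcov =>
      rpow_le_sum_of_subset_biUnion h.biUnion_image_limitSet.symm (h.nonempty_limitSet hQ hne)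
        h.finite h.nontrivial hc
        (fun i hi x hx y hy => hlow i hi x (limitSet_subset hx) y (limitSet_subset hy))
        hδ hsep hs0 hs t U d hd hU hcov
  have hpos : μH[((⟨s, hs0.le⟩ : ℝ≥0) : ℝ)] J ≠ 0 := by
    refine (lt_of_lt_of_le ?_ hmeas).ne'
    exact ENNReal.ofReal_pos.2 (Real.rpow_pos_of_pos hδ s)
  refine lt_of_lt_of_le ?_ (le_dimH_of_hausdorffMeasure_ne_zero hpos)
  exact ENNReal.one_lt_coe_iff.2 hs1

end IFS

/-! ### Weak Bloch and Koebe theorems -/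

/-- A holomorphic function on a disc covers a disc of radius comparable to `r * ‖deriv g a‖`
(a weak form of Bloch's theorem). -/
theorem exists_ball_subset_image {g : ℂ → ℂ} {a : ℂ} {r : ℝ} (hr : 0 < r)
    (hg : DifferentiableOn ℂ g (ball a r)) :
    ∃ b, ball b (r * ‖deriv g a‖ / 96) ⊆ g '' ball a r := by
  by_cases h0 : deriv g a = 0
  · exact ⟨0, by simp [h0]⟩
  have hsub : closedBall a (r / 2) ⊆ ball a r := closedBall_subset_ball (by linarith)
  have hd : DifferentiableOn ℂ (deriv g) (ball a r) := hg.deriv isOpen_ball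
  -- Landau's device: at a maximum of the derivative weighted by the distance to the circle of
  -- radius `r / 2`, the derivative at most doubles on the disc of half that distance. Schwarz's
  -- lemma then makes `g` nearly linear on a sixth of this disc.
  obtain ⟨z₀, hz₀, hmax⟩ := (isCompact_closedBall a (r / 2)).exists_isMaxOn
    (nonempty_closedBall.2 (by linarith))
    (f := fun z => ‖deriv g z‖ * (r / 2 - dist z a))
    ((hd.continuousOn.mono hsub).norm.mul (by fun_prop))
  have hM : ‖deriv g a‖ * (r / 2) ≤ ‖deriv g z₀‖ * (r / 2 - dist z₀ a) := by
    simpa using hmax (mem_closedBall_self (by linarith : 0 ≤ r / 2))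
  have hpos : 0 < ‖deriv g a‖ * (r / 2) := by positivity
  have hz₀' : 0 ≤ r / 2 - dist z₀ a := by linarith [mem_closedBall.1 hz₀]
  have hρ : 0 < (r / 2 - dist z₀ a) / 2 := by
    rcases hz₀'.eq_or_lt with h | h
    · rw [← h] at hM
      linarith
    · linarith
  set ρ := (r / 2 - dist z₀ a) / 2 with hρd
  set D := ‖deriv g z₀‖ with hD
  have hD0 : 0 < D := by
    rcases (norm_nonneg (deriv g z₀)).eq_or_lt with h | h
    · rw [hD, ← h] at hM
      linarith
    · exact h
  have hball : ball z₀ ρ ⊆ ball a r := by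
    refine ball_subset_ball' ?_
    linarith
  have hbound : ∀ z ∈ ball z₀ ρ, ‖deriv g z‖ ≤ 2 * D := by
    intro z hz
    have h1 := dist_triangle z z₀ a
    have h2 := mem_ball.1 hz
    have h3 : ‖deriv g z‖ * (r / 2 - dist z a) ≤ D * (r / 2 - dist z₀ a) :=
      hmax (mem_closedBall.2 (by linarith))
    have h4 : ‖deriv g z‖ * ρ ≤ (2 * D) * ρ := by
      have : ‖deriv g z‖ * ρ ≤ ‖deriv g z‖ * (r / 2 - dist z a) := by
        gcongr
        linarith
      have h5 : D * (r / 2 - dist z₀ a) = 2 * D * ρ := by rw [hρd]; ring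
      linarith
    exact le_of_mul_le_mul_right h4 hρ
  have hosc : ∀ z ∈ closedBall z₀ (ρ / 6), ‖deriv g z - deriv g z₀‖ ≤ D / 2 := by
    intro z hz
    have hz' := mem_closedBall.1 hz
    have := Complex.dist_le_div_mul_dist_of_mapsTo_ball (R₂ := 3 * D) (hd.mono hball)
      (fun w hw => by
        rw [mem_closedBall, dist_eq_norm]
        exact (norm_sub_le _ _).trans (by linarith [hbound w hw]))
      (show z ∈ ball z₀ ρ from mem_ball.2 (by linarith))
    rw [dist_eq_norm] at this
    calc _ ≤ 3 * D / ρ * dist z z₀ := this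
      _ ≤ 3 * D / ρ * (ρ / 6) := by gcongr
      _ = D / 2 := by field_simp; norm_num
  have hgd : ∀ z ∈ closedBall z₀ (ρ / 6), DifferentiableAt ℂ g z := fun z hz =>
    hg.differentiableAt (isOpen_ball.mem_nhds (hball (closedBall_subset_ball (by linarith) hz)))
  have hz₀m : z₀ ∈ closedBall z₀ (ρ / 6) := mem_closedBall_self (by positivity)
  have hlin : ∀ z ∈ sphere z₀ (ρ / 6), D * ρ / 12 ≤ ‖g z - g z₀‖ := by
    intro z hz
    have hzc := sphere_subset_closedBall hz
    have hder : ∀ w ∈ closedBall z₀ (ρ / 6), HasDerivWithinAt (fun w => g w - deriv g z₀ * w)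
        (deriv g w - deriv g z₀) (closedBall z₀ (ρ / 6)) w := fun w hw => by
      have := (hgd w hw).hasDerivAt.fun_sub ((hasDerivAt_id' w).const_mul (deriv g z₀))
      rw [mul_one] at this
      exact this.hasDerivWithinAt
    have := (convex_closedBall z₀ (ρ / 6)).norm_image_sub_le_of_norm_hasDerivWithin_le hder hosc
      hz₀m hzc
    have hzn : ‖z - z₀‖ = ρ / 6 := by rwa [mem_sphere, dist_eq_norm] at hz
    rw [hzn, show g z - deriv g z₀ * z - (g z₀ - deriv g z₀ * z₀) =
      (g z - g z₀) - deriv g z₀ * (z - z₀) by ring] at this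
    have h2 := norm_sub_norm_le (deriv g z₀ * (z - z₀)) (g z - g z₀)
    rw [norm_sub_rev (deriv g z₀ * (z - z₀)), norm_mul, hzn] at h2
    linarith
  have hne : ∃ᶠ z in 𝓝 z₀, g z ≠ g z₀ :=
    (((hgd z₀ hz₀m).hasDerivAt.eventually_ne (norm_pos_iff.1 hD0)).frequently).filter_mono
      nhdsWithin_le_nhds
  have hcl : DiffContOnCl ℂ g (ball z₀ (ρ / 6)) :=
    (hg.mono (by
      rw [closure_ball _ (by positivity)]
      exact (closedBall_subset_ball (by linarith)).trans hball)).diffContOnCl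
  -- The covered radius is half of `D * ρ / 12`, and `D * ρ ≥ r * ‖deriv g a‖ / 4` by maximality,
  -- which gives `96`.
  refine ⟨g z₀, (ball_subset_ball ?_).trans
    ((hcl.ball_subset_image_closedBall (by positivity) hlin hne).trans
      (image_mono ((closedBall_subset_ball (by linarith)).trans hball)))⟩
  have : D * (r / 2 - dist z₀ a) = 2 * (D * ρ) := by rw [hρd]; ring
  linarith

/-- The image contains no two points differing by `2πi`, hence no disc of radius greater than `π`.
The constant is `96 * 4`, with `π ≤ 4`. -/
theorem mul_norm_deriv_le_of_injOn_exp {g : ℂ → ℂ} {a : ℂ} {r : ℝ} (hr : 0 < r)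
    (hg : DifferentiableOn ℂ g (ball a r)) (hinj : InjOn (fun z => Complex.exp (g z)) (ball a r)) :
    r * ‖deriv g a‖ ≤ 384 := by
  obtain ⟨b, hb⟩ := exists_ball_subset_image hr hg
  by_contra! h
  have hR : Real.pi < r * ‖deriv g a‖ / 96 := by linarith [Real.pi_le_four]
  have hmem : ∀ ε : ℝ, |ε| = 1 → b + ε * Real.pi * Complex.I ∈ ball b (r * ‖deriv g a‖ / 96) := by
    intro ε hε
    simp [dist_eq_norm, hε, abs_of_pos Real.pi_pos, hR]
  obtain ⟨x, hx, hgx⟩ := hb (hmem 1 (by simp))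
  obtain ⟨y, hy, hgy⟩ := hb (hmem (-1) (by simp))
  have hxy : x = y := hinj hx hy (by
    simp only [hgx, hgy]
    rw [Complex.exp_eq_exp_iff_exists_int]
    exact ⟨1, by push_cast; ring⟩)
  rw [hxy, hgy] at hgx
  have := congrArg Complex.im hgx
  simp at this
  linarith [Real.pi_pos]

theorem exists_log_sub {g : ℂ → ℂ} {a w₀ : ℂ} {r : ℝ} (hr : 0 < r)
    (hg : DifferentiableOn ℂ g (ball a r)) (hw : w₀ ∉ g '' ball a r) :
    ∃ v : ℂ → ℂ, (∀ z ∈ ball a r, HasDerivAt v (deriv g z / (g z - w₀)) z) ∧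
      ∀ z ∈ ball a r, Complex.exp (v z) = g z - w₀ := by
  have hne : ∀ z ∈ ball a r, g z - w₀ ≠ 0 := fun z hz e => hw ⟨z, hz, sub_eq_zero.1 e⟩
  have hex : Complex.IsExactOn (fun z => deriv g z / (g z - w₀)) (ball a r) :=
    ((hg.deriv isOpen_ball).div (hg.sub_const w₀) hne).isExactOn_ball
  obtain ⟨v, hva, hv⟩ := hex.with_val_at a (Complex.log (g a - w₀))
  refine ⟨v, hv, fun z hz => ?_⟩
  have ha : a ∈ ball a r := mem_ball_self hr
  have hder : ∀ z ∈ ball a r, HasDerivWithinAt (fun z => (g z - w₀) * Complex.exp (-v z)) 0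
      (ball a r) z := by
    intro z hz
    have h1 := ((hg.differentiableAt (isOpen_ball.mem_nhds hz)).hasDerivAt.sub_const w₀).mul
      (hv z hz).neg.cexp
    refine (h1.congr_deriv ?_).hasDerivWithinAt
    field_simp [hne z hz]
    ring
  have hconst := (convex_ball a r).norm_image_sub_le_of_norm_hasDerivWithin_le (C := 0) hder
    (fun _ _ => by simp) ha hz
  rw [zero_mul, norm_le_zero_iff, sub_eq_zero, hva, Complex.exp_neg, Complex.exp_neg,
    Complex.exp_log (hne a ha), mul_inv_cancel₀ (hne a ha)] at hconst
  exact (eq_of_mul_inv_eq_one hconst).symm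

/-- A weak form of the Koebe quarter theorem. -/
theorem mul_norm_deriv_le_of_injOn {g : ℂ → ℂ} {a w₀ : ℂ} {r : ℝ} (hr : 0 < r)
    (hg : DifferentiableOn ℂ g (ball a r)) (hinj : InjOn g (ball a r)) (hw : w₀ ∉ g '' ball a r) :
    r * ‖deriv g a‖ ≤ 384 * ‖g a - w₀‖ := by
  obtain ⟨v, hv, hexp⟩ := exists_log_sub hr hg hw
  have ha : a ∈ ball a r := mem_ball_self hr
  have h := mul_norm_deriv_le_of_injOn_exp hr
    (fun z hz => (hv z hz).differentiableAt.differentiableWithinAt) (fun x hx y hy hxy => by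
      simp only [hexp x hx, hexp y hy] at hxy
      exact hinj hx hy (sub_left_injective hxy))
  have hne : 0 < ‖g a - w₀‖ := norm_pos_iff.2 fun e => hw ⟨a, ha, sub_eq_zero.1 e⟩
  rwa [(hv a ha).deriv, norm_div, ← mul_div_assoc, div_le_iff₀ hne] at h

/-- By injectivity `g` omits the value `g z` on the disc about `a` of radius `min (dist z a) r`, so
the Koebe bound becomes a lower bound for `dist (g z) (g a)`. -/
theorem min_mul_norm_deriv_le {g : ℂ → ℂ} {U : Set ℂ} {a z : ℂ} {r : ℝ}
    (hg : DifferentiableOn ℂ g U) (hinj : InjOn g U) (hU : ball a r ⊆ U) (hr : 0 < r)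
    (hz : z ∈ U) : min (dist z a) r * ‖deriv g a‖ ≤ 384 * dist (g z) (g a) := by
  by_cases hza : z = a
  · simp [hza, hr.le]
  have hpos : 0 < min (dist z a) r := lt_min (dist_pos.2 hza) hr
  have hsub : ball a (min (dist z a) r) ⊆ U := (ball_subset_ball (min_le_right _ _)).trans hU
  have := mul_norm_deriv_le_of_injOn hpos (hg.mono hsub) (hinj.mono hsub) (w₀ := g z) (by
    rintro ⟨y, hy, hyz⟩
    rw [hinj (hsub hy) hz hyz] at hy
    exact (mem_ball.1 hy).not_ge (min_le_left _ _))
  rwa [dist_comm (g z), dist_eq_norm (g a)]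

/-! ### Distortion of conformal maps -/

/-- `g : U → V` and `F : V → U` are mutually inverse holomorphic maps between open sets. -/
structure ConformalEquivOn (g F : ℂ → ℂ) (U V : Set ℂ) : Prop where
  isOpen_source : IsOpen U
  isOpen_target : IsOpen V
  differentiableOn : DifferentiableOn ℂ g U
  differentiableOn_symm : DifferentiableOn ℂ F V
  mapsTo : MapsTo g U V
  mapsTo_symm : MapsTo F V U
  invOn : InvOn F g U V

namespace ConformalEquivOn

variable {g F : ℂ → ℂ} {U V : Set ℂ} {a w : ℂ} {r : ℝ}

theorem differentiableAt (h : ConformalEquivOn g F U V) (ha : a ∈ U) : DifferentiableAt ℂ g a :=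
  h.differentiableOn.differentiableAt (h.isOpen_source.mem_nhds ha)

theorem differentiableAt_symm (h : ConformalEquivOn g F U V) (ha : a ∈ V) :
    DifferentiableAt ℂ F a :=
  h.differentiableOn_symm.differentiableAt (h.isOpen_target.mem_nhds ha)

theorem injOn (h : ConformalEquivOn g F U V) : InjOn g U := h.invOn.1.injOn

theorem deriv_symm_mul_deriv (h : ConformalEquivOn g F U V) (ha : a ∈ U) :
    deriv F (g a) * deriv g a = 1 := by
  have h1 := (h.differentiableAt_symm (h.mapsTo ha)).hasDerivAt.comp a
    (h.differentiableAt ha).hasDerivAt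
  refine h1.unique ((hasDerivAt_id a).congr_of_eventuallyEq ?_)
  filter_upwards [h.isOpen_source.mem_nhds ha] with x hx using h.invOn.1 hx

theorem norm_deriv_pos (h : ConformalEquivOn g F U V) (ha : a ∈ U) : 0 < ‖deriv g a‖ :=
  norm_pos_iff.2 (right_ne_zero_of_mul_eq_one (h.deriv_symm_mul_deriv ha))

/-- If the image contained the whole disc of radius `2 * r * ‖deriv g a‖`, Schwarz's lemma for the
inverse would give `|F'| ≤ 1 / (2 |g'|)`, contradicting `F' g' = 1`. -/
theorem exists_notMem_image (h : ConformalEquivOn g F U V) (hr : 0 < r) (hU : ball a r ⊆ U) :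
    ∃ w₀ ∉ g '' ball a r, ‖g a - w₀‖ ≤ 2 * r * ‖deriv g a‖ := by
  have ha : a ∈ U := hU (mem_ball_self hr)
  have hpos := h.norm_deriv_pos ha
  by_contra! hcon
  set ρ := 2 * r * ‖deriv g a‖ with hρ
  have hρ0 : 0 < ρ := by positivity
  have hsub : ∀ w ∈ ball (g a) ρ, ∃ z ∈ ball a r, g z = w := by
    intro w hw
    by_contra hn
    have := hcon w hn
    rw [mem_ball, dist_comm, dist_eq_norm] at hw
    linarith
  have h1 := Complex.norm_deriv_le_div_of_mapsTo_ball (f := F) (c := g a) (R₁ := ρ) (R₂ := r)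
    (h.differentiableOn_symm.mono fun w hw => by
      obtain ⟨z, hz, rfl⟩ := hsub w hw
      exact h.mapsTo (hU hz))
    (fun w hw => by
      obtain ⟨z, hz, rfl⟩ := hsub w hw
      rw [h.invOn.1 (hU hz), h.invOn.1 ha]
      exact ball_subset_closedBall hz) hρ0
  have h2 := congrArg norm (h.deriv_symm_mul_deriv ha)
  rw [norm_mul, norm_one] at h2
  have h3 : ‖deriv F (g a)‖ * ‖deriv g a‖ ≤ r / ρ * ‖deriv g a‖ := by gcongr
  rw [h2, hρ] at h3
  have h4 : r / (2 * r * ‖deriv g a‖) * ‖deriv g a‖ = 1 / 2 := by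
    field_simp
  rw [h4] at h3
  norm_num at h3

/-- With an omitted value `w₀` close to `g a`, the Koebe bound controls the logarithmic derivative
of `g - w₀` by `768 / r`. Over a distance `r / 2` this lets `|g - w₀|` grow by at most `exp 384`,
and a second use of the Koebe bound returns to `g'`. -/
theorem norm_deriv_le_of_mem_ball (h : ConformalEquivOn g F U V) (hr : 0 < r)
    (hU : ball a r ⊆ U) (hw : w ∈ ball a (r / 2)) :
    ‖deriv g w‖ ≤ 1536 * Real.exp 384 * ‖deriv g a‖ := by
  obtain ⟨w₀, hw₀, hnorm⟩ := h.exists_notMem_image hr hU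
  obtain ⟨v, hv, hexp⟩ := exists_log_sub hr (h.differentiableOn.mono hU) hw₀
  have hsub : ball a (r / 2) ⊆ ball a r := ball_subset_ball (by linarith)
  have hkoebe : ∀ x ∈ ball a (r / 2), ‖deriv g x‖ ≤ 768 / r * ‖g x - w₀‖ := by
    intro x hx
    have hs : ball x (r / 2) ⊆ ball a r := ball_subset_ball' (by linarith [mem_ball.1 hx])
    have := mul_norm_deriv_le_of_injOn (half_pos hr) (h.differentiableOn.mono (hs.trans hU))
      (h.injOn.mono (hs.trans hU)) (fun hmem => hw₀ (image_mono hs hmem))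
    rw [div_mul_eq_mul_div, le_div_iff₀ hr]
    linarith
  have hv' : ∀ x ∈ ball a (r / 2), ‖deriv g x / (g x - w₀)‖ ≤ 768 / r := by
    intro x hx
    rw [norm_div]
    exact div_le_of_le_mul₀ (norm_nonneg _) (by positivity) (hkoebe x hx)
  have hdiff := (convex_ball a (r / 2)).norm_image_sub_le_of_norm_hasDerivWithin_le
    (fun x hx => (hv x (hsub hx)).hasDerivWithinAt) hv' (mem_ball_self (half_pos hr)) hw
  have hwa : ‖w - a‖ ≤ r / 2 := by
    rw [← dist_eq_norm]
    exact (mem_ball.1 hw).le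
  have h384 : ‖v w - v a‖ ≤ 384 := by
    calc _ ≤ 768 / r * ‖w - a‖ := hdiff
      _ ≤ 768 / r * (r / 2) := by gcongr
      _ = 384 := by field_simp; norm_num
  have hgrow : ‖g w - w₀‖ ≤ Real.exp 384 * ‖g a - w₀‖ := by
    rw [← hexp w (hsub hw), ← hexp a (mem_ball_self hr), Complex.norm_exp, Complex.norm_exp,
      ← Real.exp_add, Real.exp_le_exp]
    have := (Complex.re_le_norm (v w - v a)).trans h384
    rw [Complex.sub_re] at this
    linarith
  calc ‖deriv g w‖ ≤ 768 / r * ‖g w - w₀‖ := hkoebe w hw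
    _ ≤ 768 / r * (Real.exp 384 * (2 * r * ‖deriv g a‖)) := by
        gcongr
        exact hgrow.trans (by gcongr)
    _ = 1536 * Real.exp 384 * ‖deriv g a‖ := by field_simp; ring

/-- The local bound is chained along a segment; steps of length `r / 4` stay strictly inside the
discs of radius `r / 2`. -/
theorem norm_deriv_le_pow (h : ConformalEquivOn g F U V) {S : Set ℂ} (hS : Convex ℝ S)
    (hr : 0 < r) (hSU : ∀ x ∈ S, ball x r ⊆ U) (N : ℕ) : ∀ x ∈ S, ∀ y ∈ S,
      dist y x ≤ N * (r / 4) → ‖deriv g y‖ ≤ (1536 * Real.exp 384) ^ N * ‖deriv g x‖ := by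
  induction N with
  | zero =>
    intro x _ y _ hd
    have : y = x := dist_le_zero.1 (by simpa using hd)
    simp [this]
  | succ N ih =>
    intro x hx y hy hd
    set t : ℝ := N / (N + 1) with ht
    set z := AffineMap.lineMap x y t with hz
    have ht0 : 0 ≤ t := by positivity
    have ht1 : 1 - t = 1 / (N + 1) := by rw [ht]; field_simp; ring
    have ht1' : 0 ≤ 1 - t := by rw [ht1]; positivity
    have hzS : z ∈ S := hS.lineMap_mem hx hy ⟨ht0, by linarith⟩
    push_cast at hd
    have h1 : dist z x ≤ N * (r / 4) := by
      rw [hz, dist_lineMap_left, Real.norm_of_nonneg ht0, dist_comm]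
      calc t * dist y x ≤ t * ((N + 1) * (r / 4)) := by gcongr
        _ = N * (r / 4) := by rw [ht]; field_simp
    have h2 : dist y z ≤ r / 4 := by
      rw [hz, dist_comm, dist_lineMap_right, Real.norm_of_nonneg ht1', dist_comm]
      calc (1 - t) * dist y x ≤ (1 - t) * ((N + 1) * (r / 4)) := by gcongr
        _ = r / 4 := by rw [ht1]; field_simp
    calc ‖deriv g y‖ ≤ 1536 * Real.exp 384 * ‖deriv g z‖ :=
          h.norm_deriv_le_of_mem_ball hr (hSU z hzS) (mem_ball.2 (by linarith))
      _ ≤ 1536 * Real.exp 384 * ((1536 * Real.exp 384) ^ N * ‖deriv g x‖) := by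
          gcongr
          exact ih x hx z hzS h1
      _ = _ := by ring

end ConformalEquivOn

/-! ### Lifts through the exponential and holomorphy of inverses -/

theorem eqOn_of_exp_eqOn {X : Type*} [TopologicalSpace X] {S : Set X} (hS : IsPreconnected S)
    {u v : X → ℂ} (hu : ContinuousOn u S) (hv : ContinuousOn v S)
    (h : ∀ x ∈ S, Complex.exp (u x) = Complex.exp (v x)) {a : X} (ha : a ∈ S) (hav : u a = v a) :
    EqOn u v S :=
  Complex.isCoveringMap_exp.eqOn_of_comp_eqOn hS hu hv (fun x hx => Subtype.ext (h x hx)) ha hav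

theorem differentiableAt_of_cexp {u : ℂ → ℂ} {z : ℂ} (hu : ContinuousAt u z)
    (h : DifferentiableAt ℂ (fun x => Complex.exp (u x)) z) : DifferentiableAt ℂ u z := by
  have hev : u =ᶠ[𝓝 z] fun x => Complex.log (Complex.exp (u x) / Complex.exp (u z)) + u z := by
    have hc : ContinuousAt (fun x => |(u x - u z).im|) z :=
      (Complex.continuous_im.continuousAt.comp (hu.sub continuousAt_const)).abs
    have hlt : |(u z - u z).im| < Real.pi := by simpa using Real.pi_pos
    filter_upwards [hc.eventually (Iio_mem_nhds hlt)] with x hx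
    have hx' := abs_lt.1 hx
    rw [← Complex.exp_sub, Complex.log_exp hx'.1 hx'.2.le, sub_add_cancel]
  refine DifferentiableAt.congr_of_eventuallyEq ?_ hev
  refine DifferentiableAt.add_const (c := u z) (DifferentiableAt.clog (h.div_const _) ?_)
  rw [div_self (Complex.exp_ne_zero _)]
  exact Complex.one_mem_slitPlane

/-- Off the critical points of `F` this is the inverse function theorem. Critical points are
isolated, since `F` is injective and hence not locally constant, so the remaining singularities of
the continuous map `g` are removable. -/
theorem differentiableOn_of_invOn {g F : ℂ → ℂ} {U V : Set ℂ} (hU : IsOpen U) (hV : IsOpen V)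
    (hF : DifferentiableOn ℂ F V) (hg : ContinuousOn g U) (hgm : MapsTo g U V)
    (hinv : InvOn F g U V) : DifferentiableOn ℂ g U := by
  have hd : ∀ w ∈ U, deriv F (g w) ≠ 0 → DifferentiableAt ℂ g w := by
    intro w hw hne
    have hst := ((hF.analyticAt (hV.mem_nhds (hgm hw))).hasStrictDerivAt).hasDerivAt
    refine (hst.of_local_left_inverse (hg.continuousAt (hU.mem_nhds hw)) hne ?_).differentiableAt
    filter_upwards [hU.mem_nhds hw] with x hx using hinv.1 hx
  intro w hw
  have hgw := hgm hw
  have hcont := hg.continuousAt (hU.mem_nhds hw)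
  refine (Complex.analyticAt_of_differentiable_on_punctured_nhds_of_continuousAt ?_ hcont).differentiableAt
    |>.differentiableWithinAt
  have han : AnalyticAt ℂ (deriv F) (g w) := (hF.analyticAt (hV.mem_nhds hgw)).deriv
  rcases han.eventually_eq_zero_or_eventually_ne_zero with h0 | h0
  · exfalso
    obtain ⟨r, hr, hball⟩ := Metric.mem_nhds_iff.1 (h0.and (hV.mem_nhds hgw))
    have hmem : g w + (r / 2 : ℝ) ∈ ball (g w) r := by
      simp [abs_of_pos hr, hr]
    have hc := (convex_ball (g w) r).norm_image_sub_le_of_norm_deriv_le (C := 0)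
      (fun x hx => hF.differentiableAt (hV.mem_nhds (hball hx).2))
      (fun x hx => by rw [(hball hx).1, norm_zero]) (mem_ball_self hr) hmem
    rw [zero_mul, norm_le_zero_iff, sub_eq_zero] at hc
    have := hinv.2.injOn (hball hmem).2 hgw hc
    simp only [add_eq_left, Complex.ofReal_eq_zero] at this
    linarith
  · have hinj : ∀ᶠ x in 𝓝[≠] w, g x ∈ ({g w}ᶜ : Set ℂ) := by
      filter_upwards [nhdsWithin_le_nhds (hU.mem_nhds hw), self_mem_nhdsWithin] with x hx hne
      exact fun e => hne (hinv.1.injOn hx hw e)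
    have ht : Tendsto g (𝓝[≠] w) (𝓝[≠] (g w)) :=
      tendsto_nhdsWithin_of_tendsto_nhds_of_eventually_within _
        (hcont.tendsto.mono_left nhdsWithin_le_nhds) hinj
    filter_upwards [ht.eventually h0, nhdsWithin_le_nhds (hU.mem_nhds hw)] with x hx hxU
    exact hd x hxU hx

/-! ### The inverse branch of the logarithmic coordinates -/

theorem isOpen_halfPlane (R₀ : ℝ) : IsOpen (halfPlane R₀) :=
  isOpen_lt continuous_const Complex.continuous_re

theorem convex_halfPlane (R₀ : ℝ) : Convex ℝ (halfPlane R₀) :=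
  convex_halfSpace_re_gt _

/-- `g` is the inverse branch of `F` with values in `L 0`, together with the properties of the
logarithmic coordinates that determine the dynamics of `F` on the lifted tracts. -/
structure IsTractBranch (g F : ℂ → ℂ) (R₀ : ℝ) (L : ℤ → Set ℂ) : Prop where
  conformal : ConformalEquivOn g F (halfPlane R₀) (L 0)
  injOn_exp : InjOn Complex.exp (L 0)
  translate : ∀ s : ℤ, L s = (fun z : ℂ => z + 2 * Real.pi * Complex.I * s) '' L 0
  periodic : ∀ z ∈ ⋃ s, L s, F (z + 2 * Real.pi * Complex.I) = F z
  re_large : ∀ B : ℝ, ∃ K : ℝ, ∀ w ∈ halfPlane R₀, K < w.re → B < (g w).re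
  re_large_of_re_eq : ∀ a : ℝ, Real.log R₀ < a → ∀ B : ℝ, ∃ N : ℝ, ∀ w : ℂ, w.re = a →
    N < ‖w‖ → B < (g w).re

/-- As `T` is simply connected and avoids `0`, it carries a branch of the logarithm; subtracting a
multiple of `2πi` places it in the chosen component, which it then fills. -/
theorem IsLogCoordinates.exists_log {f F : ℂ → ℂ} {T : Set ℂ} {R₀ : ℝ} {L : ℤ → Set ℂ}
    (hT : IsLogarithmicTract f T R₀) (h0 : (0 : ℂ) ∉ T) (hF : IsLogCoordinates f T L F) :
    ∃ ℓ : ℂ → ℂ, ContinuousOn ℓ T ∧ (∀ z ∈ T, Complex.exp (ℓ z) = z) ∧ L 0 = ℓ '' T := by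
  obtain ⟨z₁, hz₁, hL⟩ := hF.component
  obtain ⟨ℓ, hℓ, hexp⟩ := Complex.exists_continuousOn_eqOn_exp_comp
    (U := T) (g := id) hT.simplyConnected hT.isOpen continuousOn_id (by simpa using h0)
  have hz₁' : Complex.exp z₁ ∈ T := hz₁
  obtain ⟨n, hn⟩ := Complex.exp_eq_exp_iff_exists_int.1 (hexp hz₁')
  have hex : ∀ z ∈ T, Complex.exp (ℓ z - n * (2 * Real.pi * Complex.I)) = z := by
    intro z hz
    rw [Complex.exp_sub, Complex.exp_int_mul_two_pi_mul_I, div_one]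
    exact hexp hz
  refine ⟨fun z => ℓ z - n * (2 * Real.pi * Complex.I), hℓ.sub continuousOn_const, hex, ?_⟩
  have hbase : ℓ (Complex.exp z₁) - n * (2 * Real.pi * Complex.I) = z₁ := by
    rw [hn]
    ring
  rw [hL]
  apply Subset.antisymm
  · intro z hz
    have hsub := connectedComponentIn_subset (Complex.exp ⁻¹' T) z₁
    have heq := eqOn_of_exp_eqOn (isPreconnected_connectedComponentIn (x := z₁)
      (F := Complex.exp ⁻¹' T)) (u := fun z => ℓ (Complex.exp z) - n * (2 * Real.pi * Complex.I))
      (v := id) ((hℓ.comp Complex.continuous_exp.continuousOn hsub).sub continuousOn_const)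
      continuousOn_id (fun x hx => hex _ (hsub hx)) (mem_connectedComponentIn hz₁) hbase
    exact ⟨Complex.exp z, hsub hz, heq hz⟩
  · refine IsPreconnected.subset_connectedComponentIn ?_ ⟨_, hz₁', hbase⟩ ?_
    · exact hT.isConnected.isPreconnected.image _ (hℓ.sub continuousOn_const)
    · rintro _ ⟨z, hz, rfl⟩
      simpa [mem_preimage, hex z hz] using hz

theorem IsLogCoordinates.exists_isTractBranch {f F : ℂ → ℂ} {T : Set ℂ} {R₀ : ℝ} {L : ℤ → Set ℂ}
    (hT : IsLogarithmicTract f T R₀) (h0 : (0 : ℂ) ∉ T) (hF : IsLogCoordinates f T L F) :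
    ∃ g, IsTractBranch g F R₀ L := by
  obtain ⟨ℓ, hℓ, hexp, hL⟩ := hF.exists_log hT h0
  have hL0 : L 0 ⊆ ⋃ s, L s := subset_iUnion L 0
  have hℓm : ∀ t ∈ T, ℓ t ∈ L 0 := fun t ht => hL ▸ mem_image_of_mem ℓ ht
  have hLexp : ∀ z ∈ L 0, Complex.exp z ∈ T ∧ ℓ (Complex.exp z) = z := by
    intro z hz
    rw [hL] at hz
    obtain ⟨t, ht, rfl⟩ := hz
    rw [hexp t ht]
    exact ⟨ht, rfl⟩
  have hFexp : ∀ z ∈ L 0, Complex.exp (F z) = f (Complex.exp z) := fun z hz =>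
    hF.exp_comp z (hL0 hz)
  have hFH : MapsTo F (L 0) (halfPlane R₀) := by
    intro z hz
    have h1 := hT.mapsTo (hLexp z hz).1
    rw [mem_ofPred_eq, ← hFexp z hz, Complex.norm_exp] at h1
    exact (Real.log_lt_iff_lt_exp hT.pos).2 h1
  have hFc : ContinuousOn F (L 0) := hF.continuousOn.mono hL0
  have hLopen : IsOpen (L 0) := by
    obtain ⟨z₁, -, h⟩ := hF.component
    rw [h]
    exact (hT.isOpen.preimage Complex.continuous_exp).connectedComponentIn
  -- `P` is a logarithm of `f` on `T`. The lift `Φ` of `exp` through the covering `f` is its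
  -- inverse, by uniqueness of lifts in both directions, and `ℓ ∘ Φ` is the desired branch.
  set P : ℂ → ℂ := fun t => F (ℓ t) with hP
  have hPc : ContinuousOn P T := hFc.comp hℓ hℓm
  have hPH : MapsTo P T (halfPlane R₀) := fun t ht => hFH (hℓm t ht)
  have hPexp : ∀ t ∈ T, Complex.exp (P t) = f t := fun t ht => by
    rw [hP]
    simp only
    rw [hFexp _ (hℓm t ht), hexp t ht]
  obtain ⟨t₀, ht₀⟩ := hT.isConnected.nonempty
  have hmemH : ∀ w ∈ halfPlane R₀, Complex.exp w ∈ {w : ℂ | R₀ < ‖w‖} := fun w hw => by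
    rw [mem_ofPred_eq, Complex.norm_exp]
    exact (Real.log_lt_iff_lt_exp hT.pos).1 hw
  have : ContractibleSpace (halfPlane R₀) :=
    (convex_halfPlane R₀).contractibleSpace ⟨_, hPH ht₀⟩
  have : LocallyPathConnectedSpace (halfPlane R₀) := (isOpen_halfPlane R₀).locallyPathConnectedSpace
  obtain ⟨Φ, ⟨hΦ₀, hΦ⟩, -⟩ := hT.isCoveringMap.existsUnique_continuousMap_lifts
    (⟨fun w : halfPlane R₀ => ⟨Complex.exp w, hmemH w w.2⟩, by fun_prop⟩ :
      C(halfPlane R₀, {w : ℂ | R₀ < ‖w‖})) ⟨P t₀, hPH ht₀⟩ ⟨t₀, ht₀⟩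
    (Subtype.ext (hPexp t₀ ht₀).symm)
  have hfΦ : ∀ w : halfPlane R₀, f (Φ w) = Complex.exp w := fun w =>
    congrArg Subtype.val (congrFun hΦ w)
  have hΦP : ∀ t : T, Φ ⟨P t, hPH t.2⟩ = t := by
    have : PreconnectedSpace T := isPreconnected_iff_preconnectedSpace.1 hT.isConnected.isPreconnected
    have hPc' : Continuous fun t : T => (⟨P t, hPH t.2⟩ : halfPlane R₀) :=
      (continuousOn_iff_continuous_domRestrict.1 hPc).subtype_mk _
    have := hT.isCoveringMap.eq_of_comp_eq (g₁ := fun t : T => Φ ⟨P t, hPH t.2⟩) (g₂ := id)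
      (Φ.continuous.comp hPc') continuous_id
      (funext fun t => Subtype.ext ((hfΦ _).trans (hPexp t t.2))) ⟨t₀, ht₀⟩ hΦ₀
    exact fun t => congrFun this t
  have hPΦ : ∀ w : halfPlane R₀, P (Φ w) = w := by
    have hc : Continuous fun w : halfPlane R₀ => P (Φ w) :=
      hPc.comp_continuous (continuous_subtype_val.comp Φ.continuous) fun w => (Φ w).2
    have := eqOn_of_exp_eqOn (X := halfPlane R₀) (S := univ) isPreconnected_univ
      (u := fun w => P (Φ w)) (v := Subtype.val) hc.continuousOn
      continuous_subtype_val.continuousOn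
      (fun w _ => (hPexp _ (Φ w).2).trans (hfΦ w)) (mem_univ ⟨P t₀, hPH ht₀⟩)
      (by simp only [hΦ₀])
    exact fun w => this (mem_univ w)
  classical
  set g : ℂ → ℂ := fun w => if hw : w ∈ halfPlane R₀ then ℓ (Φ ⟨w, hw⟩) else 0 with hg
  have hgH : ∀ w (hw : w ∈ halfPlane R₀), g w = ℓ (Φ ⟨w, hw⟩) := fun w hw => by
    simp only [hg, dif_pos hw]
  have hgc : ContinuousOn g (halfPlane R₀) := by
    rw [continuousOn_iff_continuous_domRestrict]
    have : Continuous fun w : halfPlane R₀ => ℓ (Φ w) :=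
      hℓ.comp_continuous (continuous_subtype_val.comp Φ.continuous) fun w => (Φ w).2
    convert this using 1
    ext w
    exact hgH w w.2
  have hgm : MapsTo g (halfPlane R₀) (L 0) := fun w hw => by
    rw [hgH w hw]
    exact hℓm _ (Φ _).2
  have hinv : InvOn F g (halfPlane R₀) (L 0) := by
    refine ⟨fun w hw => ?_, fun z hz => ?_⟩
    · rw [hgH w hw]
      exact hPΦ ⟨w, hw⟩
    · obtain ⟨hzT, hzℓ⟩ := hLexp z hz
      have h1 := hΦP ⟨_, hzT⟩
      have h2 : P (Complex.exp z) = F z := by simp only [hP, hzℓ]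
      rw [hgH _ (hFH hz)]
      simp only [h2] at h1
      rw [h1]
      exact hzℓ
  have hFd : DifferentiableOn ℂ F (L 0) := by
    intro z hz
    refine (differentiableAt_of_cexp (hFc.continuousAt (hLopen.mem_nhds hz)) ?_)
      |>.differentiableWithinAt
    have hfd : DifferentiableAt ℂ (fun z => f (Complex.exp z)) z :=
      (hT.differentiableOn.differentiableAt (hT.isOpen.mem_nhds (hLexp z hz).1)).comp z
        Complex.differentiable_exp.differentiableAt
    refine hfd.congr_of_eventuallyEq ?_
    filter_upwards [hLopen.mem_nhds hz] with x hx using hFexp x hx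
  have hfg : ∀ w ∈ halfPlane R₀, f (Complex.exp (g w)) = Complex.exp w := fun w hw => by
    rw [← hFexp _ (hgm hw), hinv.1 hw]
  refine ⟨g, ⟨isOpen_halfPlane R₀, hLopen,
    differentiableOn_of_invOn (isOpen_halfPlane R₀) hLopen hFd hgc hgm hinv, hFd, hgm, hFH,
    hinv⟩, ?_, hF.translate, hF.periodic, fun B => ?_, fun a ha B => ?_⟩
  · intro x hx y hy hxy
    rw [← (hLexp x hx).2, ← (hLexp y hy).2, hxy]
  -- If `Re g(w) ≤ B`, then `exp (g w)` lies in a compact set on which `f` is bounded, while `|f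
  -- (exp (g w))| = exp (Re w)`.
  · have hcpt : IsCompact (closure T ∩ closedBall 0 (Real.exp B)) :=
      (isCompact_closedBall _ _).inter_left isClosed_closure
    obtain ⟨M, hM⟩ := hcpt.exists_bound_of_continuousOn (hT.continuousOn.mono inter_subset_left)
    refine ⟨M, fun w hw hMw => ?_⟩
    by_contra! hB
    have hmem : Complex.exp (g w) ∈ closure T ∩ closedBall 0 (Real.exp B) := by
      refine ⟨subset_closure (hLexp _ (hgm hw)).1, ?_⟩
      rw [mem_closedBall_zero_iff, Complex.norm_exp]
      exact Real.exp_le_exp.2 hB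
    have := hM _ hmem
    rw [hfg w hw, Complex.norm_exp] at this
    linarith [Real.add_one_le_exp w.re]
  -- On the line `Re w = a`, `Re g(w) ≤ B` puts `exp (g w)` in `A`. Since `a > log R₀`, the compact
  -- set `A` misses the boundary of `T`, so `P` is bounded on it; but `P (exp (g w)) = w`.
  · set A := (closure T ∩ closedBall 0 (Real.exp B)) ∩ f ⁻¹' sphere 0 (Real.exp a) with hA
    have hcpt : IsCompact (closure T ∩ closedBall 0 (Real.exp B)) :=
      (isCompact_closedBall _ _).inter_left isClosed_closure
    have hAc : IsCompact A := hcpt.of_isClosed_subset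
      ((hT.continuousOn.mono inter_subset_left).preimage_isClosed_of_isClosed hcpt.isClosed
        isClosed_sphere) inter_subset_left
    have hAT : A ⊆ T := by
      rintro z ⟨⟨hz, -⟩, hfz⟩
      by_contra hzT
      have h1 := hT.norm_eq z ⟨hz, by rwa [hT.isOpen.interior_eq]⟩
      rw [mem_preimage, mem_sphere_zero_iff_norm, h1] at hfz
      rw [hfz, Real.log_exp] at ha
      exact lt_irrefl _ ha
    obtain ⟨N, hN⟩ := hAc.exists_bound_of_continuousOn (hPc.mono hAT)
    refine ⟨N, fun w hwa hNw => ?_⟩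
    have hw : w ∈ halfPlane R₀ := by
      rw [halfPlane, mem_ofPred_eq, hwa]
      exact ha
    by_contra! hB
    have hmem : Complex.exp (g w) ∈ A := by
      refine ⟨⟨subset_closure (hLexp _ (hgm hw)).1, ?_⟩, ?_⟩
      · rw [mem_closedBall_zero_iff, Complex.norm_exp]
        exact Real.exp_le_exp.2 hB
      · rw [mem_preimage, mem_sphere_zero_iff_norm, hfg w hw, Complex.norm_exp, hwa]
    have := hN _ hmem
    simp only [hP, (hLexp _ (hgm hw)).2, hinv.1 hw] at this
    linarith

/-! ### Growth and derivative estimates for the inverse branch -/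

/-- The constant in the distortion estimate `ConformalEquivOn.norm_deriv_le_of_mem_ball`. -/
noncomputable def distortionConst : ℝ := 1536 * Real.exp 384

theorem one_le_distortionConst : 1 ≤ distortionConst := by
  have := Real.one_le_exp (show (0 : ℝ) ≤ 384 by norm_num)
  rw [distortionConst]
  linarith

namespace IsTractBranch

variable {g F : ℂ → ℂ} {R₀ : ℝ} {L : ℤ → Set ℂ}

theorem mem_halfPlane {w : ℂ} : w ∈ halfPlane R₀ ↔ Real.log R₀ < w.re := Iff.rfl

theorem ball_subset_halfPlane {w : ℂ} {r : ℝ} (hr : r ≤ w.re - Real.log R₀) :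
    ball w r ⊆ halfPlane R₀ := by
  intro z hz
  have h1 := (Complex.abs_re_le_norm (z - w)).trans_lt (by rwa [← dist_eq_norm])
  rw [Complex.sub_re] at h1
  rw [mem_halfPlane]
  linarith [(abs_lt.1 h1).1]

theorem mul_norm_deriv_le (h : IsTractBranch g F R₀ L) {w : ℂ} (hw : w ∈ halfPlane R₀) :
    (w.re - Real.log R₀) * ‖deriv g w‖ ≤ 384 := by
  have hsub := ball_subset_halfPlane (R₀ := R₀) (le_refl (w.re - Real.log R₀))
  refine mul_norm_deriv_le_of_injOn_exp (sub_pos.2 hw) (h.conformal.differentiableOn.mono hsub)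
    fun x hx y hy hxy => ?_
  exact h.conformal.injOn (hsub hx) (hsub hy)
    (h.injOn_exp (h.conformal.mapsTo (hsub hx)) (h.conformal.mapsTo (hsub hy)) hxy)

theorem norm_deriv_le_div (h : IsTractBranch g F R₀ L) {w : ℂ} {δ : ℝ} (hδ : 0 < δ)
    (hw : Real.log R₀ + δ ≤ w.re) : ‖deriv g w‖ ≤ 384 / δ := by
  rw [le_div_iff₀' hδ]
  refine le_trans ?_ (h.mul_norm_deriv_le (w := w) (mem_halfPlane.2 (by linarith)))
  gcongr
  linarith

theorem dist_le_of_norm_deriv_le (h : IsTractBranch g F R₀ L) {S : Set ℂ} (hS : Convex ℝ S)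
    (hSH : S ⊆ halfPlane R₀) {C : ℝ} (hC : ∀ w ∈ S, ‖deriv g w‖ ≤ C) {x y : ℂ} (hx : x ∈ S)
    (hy : y ∈ S) : dist (g x) (g y) ≤ C * dist x y := by
  rw [dist_eq_norm, dist_eq_norm]
  exact hS.norm_image_sub_le_of_norm_deriv_le
    (fun w hw => h.conformal.differentiableAt (hSH hw)) hC hy hx

theorem dist_le (h : IsTractBranch g F R₀ L) {δ : ℝ} (hδ : 0 < δ) {x y : ℂ}
    (hx : Real.log R₀ + δ ≤ x.re) (hy : Real.log R₀ + δ ≤ y.re) :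
    dist (g x) (g y) ≤ 384 / δ * dist x y :=
  h.dist_le_of_norm_deriv_le (convex_halfSpace_re_ge _)
    (fun w (hw : _ ≤ w.re) => mem_halfPlane.2 (by linarith))
    (fun _ hw => h.norm_deriv_le_div hδ hw) hx hy

theorem min_mul_norm_deriv_le_dist (h : IsTractBranch g F R₀ L) {x y : ℂ}
    (hx : x ∈ halfPlane R₀) (hy : y ∈ halfPlane R₀) :
    min (dist x y) (y.re - Real.log R₀) * ‖deriv g y‖ ≤ 384 * dist (g x) (g y) :=
  min_mul_norm_deriv_le h.conformal.differentiableOn h.conformal.injOn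
    (ball_subset_halfPlane le_rfl) (sub_pos.2 hy) hx

theorem norm_deriv_le_pow_mul (h : IsTractBranch g F R₀ L) {δ : ℝ} (hδ : 0 < δ) (N : ℕ) {x y : ℂ}
    (hx : Real.log R₀ + δ ≤ x.re) (hy : Real.log R₀ + δ ≤ y.re) (hd : dist y x ≤ N * (δ / 4)) :
    ‖deriv g y‖ ≤ distortionConst ^ N * ‖deriv g x‖ :=
  h.conformal.norm_deriv_le_pow (convex_halfSpace_re_ge (Real.log R₀ + δ)) hδ
    (fun w (hw : _ ≤ w.re) => ball_subset_halfPlane (by linarith)) N x hx y hy hd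

/-- Otherwise `|g'(x)| ≤ A / x²` for all large real `x`, so `Re g(x) + A / x` is nonincreasing and
`Re g` stays bounded above on the real axis. -/
theorem exists_lt_sq_mul_norm_deriv (h : IsTractBranch g F R₀ L) (M A : ℝ) :
    ∃ R : ℝ, M < R ∧ A < R ^ 2 * ‖deriv g R‖ := by
  by_contra! hcon
  set X := max (max M (Real.log R₀)) 0 + 1 with hX
  have hXM : M < X := by
    have := (le_max_left M (Real.log R₀)).trans (le_max_left _ 0)
    linarith
  have hXl : Real.log R₀ < X := by
    have := (le_max_right M (Real.log R₀)).trans (le_max_left _ 0)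
    linarith
  have hX0 : 0 < X := by
    have := le_max_right (max M (Real.log R₀)) 0
    linarith
  have hder : ∀ x : ℝ, X ≤ x →
      HasDerivAt (fun x : ℝ => (g x).re + A / x) ((deriv g x).re - A / x ^ 2) x := by
    intro x hx
    have h1 := (h.conformal.differentiableAt (a := (x : ℂ))
      (mem_halfPlane.2 (by rw [Complex.ofReal_re]; linarith))).hasDerivAt.real_of_complex
    have h2 := (hasDerivAt_inv (x := x) (by linarith)).const_mul A
    refine (h1.add h2).congr_deriv ?_
    ring
  have hanti : AntitoneOn (fun x : ℝ => (g x).re + A / x) (Ici X) := by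
    refine antitoneOn_of_deriv_nonpos (convex_Ici X)
      (fun x hx => (hder x hx).continuousAt.continuousWithinAt)
      (fun x hx => (hder x (interior_subset hx)).differentiableAt.differentiableWithinAt) ?_
    intro x hx
    have hxX : X ≤ x := interior_subset hx
    rw [(hder x hxX).deriv, sub_nonpos]
    have hx2 : 0 < x ^ 2 := by
      have : 0 < x := by linarith
      positivity
    rw [le_div_iff₀ hx2]
    calc (deriv g x).re * x ^ 2 ≤ ‖deriv g x‖ * x ^ 2 := by
          gcongr
          exact Complex.re_le_norm _
      _ ≤ A := by
          rw [mul_comm]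
          exact hcon x (by linarith)
  obtain ⟨K, hK⟩ := h.re_large ((g X).re + A / X + |A|)
  set x := max X (max K 1) + 1 with hx
  have hxX : X ≤ x := by linarith [le_max_left X (max K 1)]
  have hxK : K < x := by linarith [le_max_left K 1, le_max_right X (max K 1)]
  have hx1 : 1 ≤ x := by linarith [le_max_right K 1, le_max_right X (max K 1)]
  have h1 := hK x (mem_halfPlane.2 (by rw [Complex.ofReal_re]; linarith))
    (by rwa [Complex.ofReal_re])
  have h2 : (g x).re + A / x ≤ (g X).re + A / X := hanti (mem_Ici.2 le_rfl) hxX hxX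
  have h3 : -|A| ≤ A / x := by
    have h4 : |A / x| ≤ |A| := by
      rw [abs_div, abs_of_pos (by linarith : 0 < x)]
      exact div_le_self (abs_nonneg A) hx1
    linarith [neg_abs_le (A / x)]
  linarith

theorem eventually_re_large (h : IsTractBranch g F R₀ L) (B : ℝ) :
    ∀ᶠ R : ℝ in atTop, B < (g R).re := by
  obtain ⟨K, hK⟩ := h.re_large B
  filter_upwards [eventually_gt_atTop K, eventually_gt_atTop (Real.log R₀)] with R hR hR'
  exact hK R (mem_halfPlane.2 (by rwa [Complex.ofReal_re])) (by rwa [Complex.ofReal_re])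

/-- Far to the right `g` has Lipschitz constant `1 / 1536`, and to the right of `log R₀ + 1` it has
constant `384`. So `g (g R)` grows at most like `384 * R / 1536 = R / 4`, plus a constant `C` that
is absorbed once `R ≥ 4 * C`. -/
theorem eventually_re_comp_le (h : IsTractBranch g F R₀ L) :
    ∀ᶠ R : ℝ in atTop, (g (g R)).re ≤ R / 2 := by
  set x₀ : ℂ := ((Real.log R₀ + 1 : ℝ) : ℂ) with hx₀
  set X : ℝ := max 0 (Real.log R₀) + 384 * 1536 with hX
  have hX0 : 0 ≤ X := by linarith [le_max_left 0 (Real.log R₀)]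
  have hXl : Real.log R₀ + 384 * 1536 ≤ X := by linarith [le_max_right 0 (Real.log R₀)]
  set C : ℝ := ‖g x₀‖ + 384 * (‖g X‖ + ‖x₀‖) with hC
  filter_upwards [h.eventually_re_large (Real.log R₀ + 1), eventually_ge_atTop X,
    eventually_ge_atTop (4 * C)] with R hR hRX hRC
  have h1 : dist (g R) (g X) ≤ 384 / (384 * 1536) * dist (R : ℂ) X :=
    h.dist_le (by norm_num) (by rw [Complex.ofReal_re]; linarith) (by rwa [Complex.ofReal_re])
  have hdR : dist (R : ℂ) X ≤ R := by
    rw [dist_eq_norm, ← Complex.ofReal_sub, Complex.norm_real, Real.norm_of_nonneg (by linarith)]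
    linarith
  have h2 : dist (g (g R)) (g x₀) ≤ 384 / 1 * dist (g R) x₀ :=
    h.dist_le one_pos hR.le (by rw [hx₀, Complex.ofReal_re])
  have h3 : dist (g R) x₀ ≤ dist (g R) (g X) + ‖g X‖ + ‖x₀‖ := by
    have := dist_triangle (g R) (g X) x₀
    rw [dist_eq_norm (g X) x₀] at this
    linarith [norm_sub_le (g X) x₀]
  have h4 : (g (g R)).re ≤ dist (g (g R)) (g x₀) + ‖g x₀‖ := by
    have := Complex.re_le_norm (g (g R))
    have h5 := norm_le_norm_add_norm_sub' (g (g R)) (g x₀)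
    rw [dist_eq_norm]
    linarith
  linarith

end IsTractBranch

/-! ### Choice of the size of the square -/

/-- The conditions on the size `R` of the square under which the induced iterated function system
has a limit set of dimension greater than one. -/
structure IsAdmissible (g : ℂ → ℂ) (R₀ R : ℝ) : Prop where
  size_le : 4000 ≤ R
  log_le : Real.log R₀ ≤ R / 4
  le_re : Real.log R₀ + 10 ^ 6 + 1536 ≤ (g R).re
  re_comp_le : (g (g R)).re ≤ R / 2
  lt_sq_mul : 10 * 14 * (8 * 384 ^ 2) * distortionConst ^ 18 < R ^ 2 * ‖deriv g R‖

/-- Every condition but the last holds for all large `R`; the last is only known for arbitrarily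
large `R`, so it is imposed beyond the threshold of the others. -/
theorem IsTractBranch.exists_isAdmissible {g F : ℂ → ℂ} {R₀ : ℝ} {L : ℤ → Set ℂ}
    (h : IsTractBranch g F R₀ L) (M : ℝ) : ∃ R, M < R ∧ IsAdmissible g R₀ R := by
  obtain ⟨X, hX⟩ := eventually_atTop.1 (((eventually_ge_atTop (4000 : ℝ)).and
    (eventually_ge_atTop (4 * Real.log R₀))).and
    ((h.eventually_re_large (Real.log R₀ + 10 ^ 6 + 1536)).and h.eventually_re_comp_le))
  obtain ⟨R, hR, hlt⟩ := h.exists_lt_sq_mul_norm_deriv (max M X)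
    (10 * 14 * (8 * 384 ^ 2) * distortionConst ^ 18)
  obtain ⟨⟨h1, h2⟩, h3, h4⟩ := hX R ((le_max_right M X).trans hR.le)
  exact ⟨R, (le_max_left M X).trans_lt hR, h1, by linarith, h3.le, h4, hlt⟩

/-! ### Translated inverse branches -/

namespace IsTractBranch

variable {g F : ℂ → ℂ} {R₀ : ℝ} {L : ℤ → Set ℂ}

theorem add_mem (h : IsTractBranch g F R₀ L) {z : ℂ} (hz : z ∈ L 0) (s : ℤ) :
    z + 2 * Real.pi * Complex.I * s ∈ L s := by
  rw [h.translate s]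
  exact ⟨z, hz, rfl⟩

theorem apply_add (h : IsTractBranch g F R₀ L) {z : ℂ} (hz : z ∈ L 0) (s : ℤ) :
    F (z + 2 * Real.pi * Complex.I * s) = F z := by
  induction s using Int.induction_on with
  | zero => simp
  | succ n ih =>
    have := h.periodic _ (mem_iUnion_of_mem _ (h.add_mem hz n))
    rw [← ih, ← this]
    congr 1
    push_cast
    ring
  | pred n ih =>
    have := h.periodic _ (mem_iUnion_of_mem _ (h.add_mem hz (-n - 1)))
    rw [← ih, ← this]
    congr 1
    push_cast
    ring

theorem bijOn (h : IsTractBranch g F R₀ L) (s : ℤ) : BijOn F (L s) (halfPlane R₀) := by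
  rw [h.translate s]
  refine ⟨?_, ?_, ?_⟩
  · rintro _ ⟨z, hz, rfl⟩
    simp only [h.apply_add hz]
    exact h.conformal.mapsTo_symm hz
  · rintro _ ⟨x, hx, rfl⟩ _ ⟨y, hy, rfl⟩ hxy
    simp only [h.apply_add hx, h.apply_add hy] at hxy
    simp only [h.conformal.invOn.2.injOn hx hy hxy]
  · intro w hw
    refine ⟨_, ⟨g w, h.conformal.mapsTo hw, rfl⟩, ?_⟩
    simp only [h.apply_add (h.conformal.mapsTo hw)]
    exact h.conformal.invOn.1 hw

theorem apply_branch_add (h : IsTractBranch g F R₀ L) {w : ℂ} (hw : w ∈ halfPlane R₀) (s : ℤ) :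
    F (g w + 2 * Real.pi * Complex.I * s) = w := by
  rw [h.apply_add (h.conformal.mapsTo hw)]
  exact h.conformal.invOn.1 hw

theorem invBranch_eq (h : IsTractBranch g F R₀ L) {w : ℂ} (hw : w ∈ halfPlane R₀) (s : ℤ) :
    invBranch F L s w = g w + 2 * Real.pi * Complex.I * s := by
  have hex : ∃ z ∈ L s, F z = w :=
    ⟨_, h.add_mem (h.conformal.mapsTo hw) s, h.apply_branch_add hw s⟩
  refine (h.bijOn s).injOn (Function.invFunOn_mem hex)
    (h.add_mem (h.conformal.mapsTo hw) s) ?_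
  rw [h.apply_branch_add hw]
  exact Function.invFunOn_eq hex

theorem eq_of_mem (h : IsTractBranch g F R₀ L) {z : ℂ} {s t : ℤ} (hs : z ∈ L s) (ht : z ∈ L t) :
    s = t := by
  rw [h.translate] at hs ht
  obtain ⟨x, hx, rfl⟩ := hs
  obtain ⟨y, hy, hxy⟩ := ht
  simp only at hxy
  have hyx : y = x := h.injOn_exp hy hx (by
    rw [Complex.exp_eq_exp_iff_exists_int]
    refine ⟨s - t, ?_⟩
    push_cast
    linear_combination hxy)
  rw [hyx] at hxy
  have h2 : (2 * Real.pi * Complex.I : ℂ) ≠ 0 := Complex.two_pi_I_ne_zero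
  have := mul_left_cancel₀ h2 (add_left_cancel hxy)
  exact_mod_cast this.symm

theorem hasDerivAt_add (h : IsTractBranch g F R₀ L) {w : ℂ} (hw : w ∈ halfPlane R₀) (s : ℤ) :
    HasDerivAt F (deriv g w)⁻¹ (g w + 2 * Real.pi * Complex.I * s) := by
  have hgw := h.conformal.mapsTo hw
  have h1 := (h.conformal.differentiableAt_symm hgw).hasDerivAt
  rw [eq_inv_of_mul_eq_one_left (h.conformal.deriv_symm_mul_deriv hw)] at h1
  have h2 : HasDerivAt (fun x => F (x - 2 * Real.pi * Complex.I * s)) (deriv g w)⁻¹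
      (g w + 2 * Real.pi * Complex.I * s) := by
    refine HasDerivAt.comp_sub_const _ _ ?_
    rwa [add_sub_cancel_right]
  refine h2.congr_of_eventuallyEq ?_
  have hcont : ContinuousAt (fun x : ℂ => x - 2 * Real.pi * Complex.I * s)
      (g w + 2 * Real.pi * Complex.I * s) := by fun_prop
  have hmem : L 0 ∈ 𝓝 (g w + 2 * Real.pi * Complex.I * s - 2 * Real.pi * Complex.I * s) := by
    rw [add_sub_cancel_right]
    exact h.conformal.isOpen_target.mem_nhds hgw
  filter_upwards [hcont hmem] with x hx
  rw [← h.apply_add hx s, sub_add_cancel]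

/-- The expansion of `F` at points whose image lies far to the right. -/
theorem two_le_norm_deriv (h : IsTractBranch g F R₀ L) {z : ℂ} (hz : z ∈ ⋃ s, L s)
    (hF : Real.log R₀ + 768 ≤ (F z).re) :
    DifferentiableAt ℂ F z ∧ 2 ≤ ‖deriv F z‖ := by
  obtain ⟨s, hs⟩ := mem_iUnion.1 hz
  rw [h.translate] at hs
  obtain ⟨x, hx, rfl⟩ := hs
  simp only [h.apply_add hx] at hF ⊢
  have hw := h.conformal.mapsTo_symm hx
  have hd := h.hasDerivAt_add hw s
  rw [h.conformal.invOn.2 hx] at hd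
  refine ⟨hd.differentiableAt, ?_⟩
  have hpos := h.conformal.norm_deriv_pos hw
  rw [hd.deriv, norm_inv, le_inv_comm₀ two_pos hpos]
  refine (h.norm_deriv_le_div (by norm_num) hF).trans ?_
  norm_num

end IsTractBranch

/-! ### The iterated function system on the square -/

theorem mem_square {R : ℝ} {z : ℂ} :
    z ∈ square R ↔ (R / 2 ≤ z.re ∧ z.re ≤ 3 * R / 2) ∧ -(R / 2) ≤ z.im ∧ z.im ≤ R / 2 :=
  Iff.rfl

theorem isCompact_square (R : ℝ) : IsCompact (square R) :=
  isCompact_Icc.reProdIm isCompact_Icc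

theorem norm_two_pi_I_mul (s : ℤ) : ‖(2 * Real.pi * Complex.I * s : ℂ)‖ = 2 * Real.pi * |(s : ℝ)| := by
  simp [abs_of_pos Real.pi_pos]

theorem two_pi_le_seven : 2 * Real.pi ≤ 7 := by
  linarith [Real.pi_lt_d2]

namespace IsAdmissible

variable {g F : ℂ → ℂ} {R₀ R : ℝ} {L : ℤ → Set ℂ}

theorem le_re_of_mem (hA : IsAdmissible g R₀ R) {x : ℂ} (hx : x ∈ square R) :
    Real.log R₀ + R / 4 ≤ x.re := by
  linarith [(mem_square.1 hx).1.1, hA.log_le]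

theorem square_subset (hA : IsAdmissible g R₀ R) : square R ⊆ halfPlane R₀ := fun x hx =>
  IsTractBranch.mem_halfPlane.2 (by linarith [hA.le_re_of_mem hx, hA.size_le])

theorem self_mem (hA : IsAdmissible g R₀ R) : (R : ℂ) ∈ square R := by
  have := hA.size_le
  rw [mem_square, Complex.ofReal_re, Complex.ofReal_im]
  refine ⟨⟨?_, ?_⟩, ?_, ?_⟩ <;> linarith

theorem dist_center_le {x : ℂ} (hx : x ∈ square R) : dist x R ≤ R := by
  obtain ⟨⟨h1, h2⟩, h3, h4⟩ := mem_square.1 hx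
  rw [dist_eq_norm]
  refine (Complex.norm_le_abs_re_add_abs_im _).trans ?_
  rw [Complex.sub_re, Complex.sub_im, Complex.ofReal_re, Complex.ofReal_im, sub_zero]
  have h5 : |x.re - R| ≤ R / 2 := abs_le.2 ⟨by linarith, by linarith⟩
  have h6 : |x.im| ≤ R / 2 := abs_le.2 ⟨by linarith, by linarith⟩
  linarith

theorem dist_branch_le (hA : IsAdmissible g R₀ R) (h : IsTractBranch g F R₀ L) {x : ℂ}
    (hx : x ∈ square R) : dist (g x) (g R) ≤ 1536 := by
  have hR : 0 < R := by linarith [hA.size_le]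
  calc dist (g x) (g R) ≤ 384 / (R / 4) * dist x R :=
        h.dist_le (by positivity) (hA.le_re_of_mem hx) (hA.le_re_of_mem hA.self_mem)
    _ ≤ 384 / (R / 4) * R := by
        gcongr
        exact dist_center_le hx
    _ = 1536 := by field_simp; norm_num

theorem le_re_branch (hA : IsAdmissible g R₀ R) (h : IsTractBranch g F R₀ L) {x : ℂ}
    (hx : x ∈ square R) (s : ℤ) :
    Real.log R₀ + 10 ^ 6 ≤ (g x + 2 * Real.pi * Complex.I * s).re := by
  have h1 := hA.dist_branch_le h hx
  rw [dist_eq_norm] at h1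
  have h2 := (abs_le.1 ((Complex.abs_re_le_norm _).trans h1)).1
  rw [Complex.sub_re] at h2
  have h3 : (g x + 2 * Real.pi * Complex.I * s).re = (g x).re := by simp
  rw [h3]
  linarith [hA.le_re]

theorem branch_mem (hA : IsAdmissible g R₀ R) (h : IsTractBranch g F R₀ L) {x : ℂ}
    (hx : x ∈ square R) (s : ℤ) : g x + 2 * Real.pi * Complex.I * s ∈ halfPlane R₀ :=
  IsTractBranch.mem_halfPlane.2 (by linarith [hA.le_re_branch h hx s])

theorem invBranch₂_eq (hA : IsAdmissible g R₀ R) (h : IsTractBranch g F R₀ L) {x : ℂ}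
    (hx : x ∈ square R) (p : ℤ × ℤ) : invBranch₂ F L p x =
      g (g x + 2 * Real.pi * Complex.I * p.2) + 2 * Real.pi * Complex.I * p.1 := by
  rw [invBranch₂, Function.comp_apply, h.invBranch_eq (hA.square_subset hx),
    h.invBranch_eq (hA.branch_mem h hx p.2)]

theorem apply_invBranch₂ (hA : IsAdmissible g R₀ R) (h : IsTractBranch g F R₀ L) {x : ℂ}
    (hx : x ∈ square R) (p : ℤ × ℤ) :
    F (invBranch₂ F L p x) = g x + 2 * Real.pi * Complex.I * p.2 := by
  rw [hA.invBranch₂_eq h hx, h.apply_branch_add (hA.branch_mem h hx p.2)]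

theorem apply_apply_invBranch₂ (hA : IsAdmissible g R₀ R) (h : IsTractBranch g F R₀ L) {x : ℂ}
    (hx : x ∈ square R) (p : ℤ × ℤ) : F (F (invBranch₂ F L p x)) = x := by
  rw [hA.apply_invBranch₂ h hx, h.apply_branch_add (hA.square_subset hx)]

theorem invBranch₂_mem (hA : IsAdmissible g R₀ R) (h : IsTractBranch g F R₀ L) {x : ℂ}
    (hx : x ∈ square R) (p : ℤ × ℤ) : invBranch₂ F L p x ∈ L p.1 := by
  rw [hA.invBranch₂_eq h hx]
  exact h.add_mem (h.conformal.mapsTo (hA.branch_mem h hx p.2)) p.1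

theorem dist_branch_branch_le (hA : IsAdmissible g R₀ R) (h : IsTractBranch g F R₀ L) {x y : ℂ}
    (hx : x ∈ square R) (hy : y ∈ square R) (s : ℤ) :
    dist (g (g x + 2 * Real.pi * Complex.I * s)) (g (g y + 2 * Real.pi * Complex.I * s)) ≤
      384 / 10 ^ 6 * dist (g x) (g y) := by
  have := h.dist_le (by norm_num) (hA.le_re_branch h hx s) (hA.le_re_branch h hy s)
  rwa [dist_add_right] at this

theorem lipschitz (hA : IsAdmissible g R₀ R) (h : IsTractBranch g F R₀ L) (p : ℤ × ℤ) :
    LipschitzOnWith (1 / 2) (invBranch₂ F L p) (square R) := by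
  refine LipschitzOnWith.of_dist_le_mul fun x hx y hy => ?_
  rw [hA.invBranch₂_eq h hx, hA.invBranch₂_eq h hy, dist_add_right]
  have hR := hA.size_le
  have h1 : dist (g x) (g y) ≤ 384 / (R / 4) * dist x y :=
    h.dist_le (by positivity) (hA.le_re_of_mem hx) (hA.le_re_of_mem hy)
  have h2 : 384 / (R / 4) ≤ 16 := by
    rw [div_le_iff₀ (by positivity)]
    linarith
  push_cast
  calc _ ≤ 384 / 10 ^ 6 * dist (g x) (g y) := hA.dist_branch_branch_le h hx hy p.2
    _ ≤ 384 / 10 ^ 6 * (16 * dist x y) := by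
        gcongr
        exact h1.trans (by gcongr)
    _ ≤ 1 / 2 * dist x y := by
        rw [← mul_assoc]
        gcongr
        norm_num

/-- A lower bound for the contraction of `invBranch₂ F L p` on the square. -/
theorem mul_dist_le (hA : IsAdmissible g R₀ R) (h : IsTractBranch g F R₀ L) (p : ℤ × ℤ) {x y : ℂ}
    (hx : x ∈ square R) (hy : y ∈ square R) :
    ‖deriv g R‖ * ‖deriv g (g R + 2 * Real.pi * Complex.I * p.2)‖ /
      (8 * 384 ^ 2 * distortionConst ^ 17) * dist x y ≤
        dist (invBranch₂ F L p x) (invBranch₂ F L p y) := by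
  have hK : 0 < distortionConst := one_pos.trans_le one_le_distortionConst
  have hR : 0 < R := by linarith [hA.size_le]
  rw [hA.invBranch₂_eq h hx, hA.invBranch₂_eq h hy, dist_add_right]
  set w : ℂ := 2 * Real.pi * Complex.I * p.2 with hw
  have hd : dist x y ≤ 2 * R := by
    have := dist_triangle_right x y (R : ℂ)
    linarith [dist_center_le hx, dist_center_le hy]
  -- Points of the square are at most `2 * R` apart and at least `R / 4` inside the half-plane, so
  -- the minimum is at least an eighth of their distance.
  have h1 : dist x y / 8 * ‖deriv g y‖ ≤ 384 * dist (g x) (g y) := by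
    refine le_trans ?_
      (h.min_mul_norm_deriv_le_dist (hA.square_subset hx) (hA.square_subset hy))
    gcongr
    refine le_min (by linarith [dist_nonneg (x := x) (y := y)]) ?_
    linarith [hA.le_re_of_mem hy]
  -- A distance of at most `R` is covered by `16` steps of length `(R / 4) / 4`.
  have h2 : ‖deriv g R‖ ≤ distortionConst ^ 16 * ‖deriv g y‖ := by
    refine h.norm_deriv_le_pow_mul (δ := R / 4) (by positivity) 16 (hA.le_re_of_mem hy)
      (hA.le_re_of_mem hA.self_mem) ?_
    rw [dist_comm]
    refine (dist_center_le hy).trans ?_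
    push_cast
    linarith
  have h3 : dist (g x) (g y) * ‖deriv g (g y + w)‖ ≤ 384 * dist (g (g x + w)) (g (g y + w)) := by
    refine le_trans ?_
      (h.min_mul_norm_deriv_le_dist (hA.branch_mem h hx p.2) (hA.branch_mem h hy p.2))
    gcongr
    rw [dist_add_right]
    -- `g` maps the square to a set of diameter at most `3072`, far below the distance `10 ^ 6` to
    -- the boundary line.
    refine le_min le_rfl ?_
    have := dist_triangle_right (g x) (g y) (g R)
    linarith [hA.dist_branch_le h hx, hA.dist_branch_le h hy, hA.le_re_branch h hy p.2]
  have h4 : ‖deriv g (g R + w)‖ ≤ distortionConst ^ 1 * ‖deriv g (g y + w)‖ := by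
    refine h.norm_deriv_le_pow_mul (δ := 10 ^ 6) (by norm_num) 1 (hA.le_re_branch h hy p.2)
      (hA.le_re_branch h hA.self_mem p.2) ?_
    rw [dist_add_right, dist_comm]
    refine (hA.dist_branch_le h hy).trans ?_
    norm_num
  rw [pow_one] at h4
  rw [div_mul_eq_mul_div, div_le_iff₀ (by positivity)]
  calc ‖deriv g R‖ * ‖deriv g (g R + w)‖ * dist x y
      ≤ (distortionConst ^ 16 * ‖deriv g y‖) * (distortionConst * ‖deriv g (g y + w)‖) *
          dist x y := by gcongr
    _ = 8 * distortionConst ^ 17 * (dist x y / 8 * ‖deriv g y‖) * ‖deriv g (g y + w)‖ := by ring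
    _ ≤ 8 * distortionConst ^ 17 * (384 * dist (g x) (g y)) * ‖deriv g (g y + w)‖ := by gcongr
    _ = 8 * 384 * distortionConst ^ 17 * (dist (g x) (g y) * ‖deriv g (g y + w)‖) := by ring
    _ ≤ 8 * 384 * distortionConst ^ 17 * (384 * dist (g (g x + w)) (g (g y + w))) := by gcongr
    _ = dist (g (g x + w)) (g (g y + w)) * (8 * 384 ^ 2 * distortionConst ^ 17) := by ring

theorem exists_re_large (hA : IsAdmissible g R₀ R) (h : IsTractBranch g F R₀ L) (B : ℝ) :
    ∃ N : ℝ, ∀ s : ℤ, N < |(s : ℝ)| → B < (g (g R + 2 * Real.pi * Complex.I * s)).re := by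
  obtain ⟨N, hN⟩ := h.re_large_of_re_eq (g R).re (by linarith [hA.le_re]) B
  refine ⟨N + ‖g R‖, fun s hs => hN _ (by simp) ?_⟩
  have h1 := norm_sub_le_norm_add (2 * Real.pi * Complex.I * s : ℂ) (g R)
  rw [norm_two_pi_I_mul, add_comm] at h1
  have h2 : |(s : ℝ)| ≤ 2 * Real.pi * |(s : ℝ)| :=
    le_mul_of_one_le_left (abs_nonneg _) (by linarith [Real.pi_gt_three])
  linarith

theorem finite_setOf_abs_le (B : ℝ) : {n : ℤ | |(n : ℝ)| ≤ B}.Finite := by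
  refine (finite_Icc (-⌈B⌉) ⌈B⌉).subset fun n hn => ?_
  have h1 := abs_le.1 (hn.trans (Int.le_ceil B))
  exact ⟨by exact_mod_cast h1.1, by exact_mod_cast h1.2⟩

/-- Tracking the image of the centre suffices: for large `|s|` it lies to the right of the square,
and for each remaining `s` its imaginary part bounds `u`. -/
theorem finite_goodPairs (hA : IsAdmissible g R₀ R) (h : IsTractBranch g F R₀ L) :
    (goodPairs F L R).Finite := by
  obtain ⟨N, hN⟩ := hA.exists_re_large h (3 * R / 2)
  refine ((finite_setOf_abs_le N).biUnion fun s _ => (finite_setOf_abs_le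
    (R / 2 + |(g (g R + 2 * Real.pi * Complex.I * s)).im|)).image fun u => (u, s)).subset ?_
  rintro ⟨u, s⟩ hp
  have hmem := hp (mem_image_of_mem _ hA.self_mem)
  rw [hA.invBranch₂_eq h hA.self_mem] at hmem
  obtain ⟨⟨-, h1⟩, h2, h3⟩ := mem_square.1 hmem
  simp only at h1 h2 h3
  set q := g (g R + 2 * Real.pi * Complex.I * s) with hq
  have hre : (q + 2 * Real.pi * Complex.I * u).re = q.re := by simp
  have him : (q + 2 * Real.pi * Complex.I * u).im = q.im + 2 * Real.pi * u := by simp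
  rw [hre] at h1
  rw [him] at h2 h3
  refine mem_biUnion (x := s) ?_ ⟨u, ?_, rfl⟩
  · by_contra hs
    exact (hN s (not_le.1 hs)).not_ge h1
  · have h4 : |2 * Real.pi * (u : ℝ)| ≤ R / 2 + |q.im| := by
      have h5 := neg_abs_le q.im
      have h6 := le_abs_self q.im
      exact abs_le.2 ⟨by linarith, by linarith⟩
    rw [abs_mul, abs_of_pos Real.two_pi_pos] at h4
    refine le_trans ?_ h4
    exact le_mul_of_one_le_left (abs_nonneg _) (by linarith [Real.pi_gt_three])

/-- The image of the square stays within distance `384 * 1536 / 10 ^ 6 < 1` of the image of its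
centre, so a margin of one is enough. -/
theorem mem_goodPairs (hA : IsAdmissible g R₀ R) (h : IsTractBranch g F R₀ L) {u s : ℤ}
    (h1 : R / 2 + 1 ≤ (g (g R + 2 * Real.pi * Complex.I * s)).re)
    (h2 : (g (g R + 2 * Real.pi * Complex.I * s)).re ≤ 3 * R / 2 - 1)
    (h3 : |(g (g R + 2 * Real.pi * Complex.I * s)).im + 2 * Real.pi * u| ≤ R / 2 - 1) :
    (u, s) ∈ goodPairs F L R := by
  rintro _ ⟨x, hx, rfl⟩
  rw [hA.invBranch₂_eq h hx]
  simp only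
  have hd : dist (g (g x + 2 * Real.pi * Complex.I * s)) (g (g R + 2 * Real.pi * Complex.I * s))
      ≤ 1 := by
    refine (hA.dist_branch_branch_le h hx hA.self_mem s).trans ?_
    calc _ ≤ 384 / 10 ^ 6 * (1536 : ℝ) := by
          gcongr
          exact hA.dist_branch_le h hx
      _ ≤ 1 := by norm_num
  rw [dist_eq_norm] at hd
  set q := g (g R + 2 * Real.pi * Complex.I * s) with hq
  set z := g (g x + 2 * Real.pi * Complex.I * s) with hz
  have hre : (z + 2 * Real.pi * Complex.I * u).re = z.re := by simp
  have him : (z + 2 * Real.pi * Complex.I * u).im = z.im + 2 * Real.pi * u := by simp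
  have h4 := abs_le.1 ((Complex.abs_re_le_norm _).trans hd)
  have h5 := abs_le.1 ((Complex.abs_im_le_norm _).trans hd)
  rw [Complex.sub_re] at h4
  rw [Complex.sub_im] at h5
  have h6 := abs_le.1 h3
  rw [mem_square, hre, him]
  refine ⟨⟨?_, ?_⟩, ?_, ?_⟩ <;> linarith [h4.1, h4.2, h5.1, h5.2, h6.1, h6.2]

/-- The allowed `u` fill an interval of length `(R - 2) / (2π) ≥ (R - 2) / 7`, and rounding its ends
to integers loses at most one. -/
theorem exists_finset_card_ge (hR : 4000 ≤ R) (y : ℝ) :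
    ∃ U : Finset ℤ, (∀ u ∈ U, |y + 2 * Real.pi * u| ≤ R / 2 - 1) ∧ R / 10 ≤ U.card := by
  have hpi := Real.two_pi_pos
  refine ⟨Finset.Icc ⌈(-(R / 2 - 1) - y) / (2 * Real.pi)⌉ ⌊((R / 2 - 1) - y) / (2 * Real.pi)⌋,
    fun u hu => ?_, ?_⟩
  · obtain ⟨h1, h2⟩ := Finset.mem_Icc.1 hu
    rw [Int.ceil_le, div_le_iff₀ hpi] at h1
    rw [Int.le_floor, le_div_iff₀ hpi] at h2
    exact abs_le.2 ⟨by linarith, by linarith⟩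
  · rw [Int.card_Icc]
    set a := (-(R / 2 - 1) - y) / (2 * Real.pi) with ha
    set b := ((R / 2 - 1) - y) / (2 * Real.pi) with hb
    have h1 := Int.ceil_lt_add_one a
    have h2 := Int.lt_floor_add_one b
    have h3 : ((⌊b⌋ + 1 - ⌈a⌉ : ℤ) : ℝ) ≤ ((⌊b⌋ + 1 - ⌈a⌉).toNat : ℝ) := by
      exact_mod_cast Int.self_le_toNat _
    push_cast at h3
    have h4 : b - a = (R - 2) / (2 * Real.pi) := by
      rw [ha, hb]
      ring
    have h5 : (R - 2) / 7 ≤ (R - 2) / (2 * Real.pi) :=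
      div_le_div_of_nonneg_left (by linarith) hpi two_pi_le_seven
    linarith

/-- The sequence `Re g(p n)` starts at or below `R / 2` and eventually exceeds `3 * R / 2`. Each
jump is at most `7 * distortionConst * ‖deriv g (p n)‖`, so the derivatives at the indices inside
the range must account for a climb of `R - 4 ≥ R / 2`. -/
theorem exists_finset_sum_ge (hA : IsAdmissible g R₀ R) (h : IsTractBranch g F R₀ L) :
    ∃ S : Finset ℕ, (∀ n ∈ S, R / 2 + 1 ≤ (g (g R + 2 * Real.pi * Complex.I * (n : ℤ))).re ∧
      (g (g R + 2 * Real.pi * Complex.I * (n : ℤ))).re ≤ 3 * R / 2 - 1) ∧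
      R / (14 * distortionConst) ≤
        ∑ n ∈ S, ‖deriv g (g R + 2 * Real.pi * Complex.I * (n : ℤ))‖ := by
  have hK : 0 < distortionConst := one_pos.trans_le one_le_distortionConst
  have hR := hA.size_le
  set p : ℕ → ℂ := fun n => g R + 2 * Real.pi * Complex.I * (n : ℤ) with hp
  have hpre : ∀ n, Real.log R₀ + 10 ^ 6 ≤ (p n).re := fun n => hA.le_re_branch h hA.self_mem n
  have hstep : ∀ n, dist (p (n + 1)) (p n) ≤ 7 := by
    intro n
    have : p (n + 1) - p n = 2 * Real.pi * Complex.I * (1 : ℤ) := by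
      simp only [hp]
      push_cast
      ring
    rw [dist_eq_norm, this, norm_two_pi_I_mul]
    simpa using two_pi_le_seven
  have hq1 : ∀ n, |(g (p (n + 1))).re - (g (p n)).re| ≤ 1 := by
    intro n
    rw [← Complex.sub_re]
    refine (Complex.abs_re_le_norm _).trans ?_
    rw [← dist_eq_norm]
    refine (h.dist_le (by norm_num) (hpre (n + 1)) (hpre n)).trans ?_
    calc _ ≤ 384 / 10 ^ 6 * (7 : ℝ) := by
          gcongr
          exact hstep n
      _ ≤ 1 := by norm_num
  have hqK : ∀ n, |(g (p (n + 1))).re - (g (p n)).re| ≤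
      7 * distortionConst * ‖deriv g (p n)‖ := by
    intro n
    rw [← Complex.sub_re]
    refine (Complex.abs_re_le_norm _).trans ?_
    rw [← dist_eq_norm]
    have hcl : p n ∈ closedBall (p n) 7 ∩ {w | Real.log R₀ + 10 ^ 6 ≤ w.re} :=
      ⟨mem_closedBall_self (by norm_num), hpre n⟩
    have := h.dist_le_of_norm_deriv_le
      (S := closedBall (p n) 7 ∩ {w | Real.log R₀ + 10 ^ 6 ≤ w.re})
      (C := distortionConst * ‖deriv g (p n)‖)
      ((convex_closedBall _ _).inter (convex_halfSpace_re_ge _))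
      (fun w hw => IsTractBranch.mem_halfPlane.2 (by linarith [mem_ofPred_eq ▸ hw.2]))
      (fun w hw => by
        have := h.norm_deriv_le_pow_mul (δ := 10 ^ 6) (by norm_num) 1 (hpre n) hw.2
          ((mem_closedBall.1 hw.1).trans (by norm_num))
        rwa [pow_one] at this)
      (x := p (n + 1)) (y := p n) ⟨mem_closedBall.2 (hstep n), hpre (n + 1)⟩ hcl
    refine this.trans ?_
    calc _ ≤ distortionConst * ‖deriv g (p n)‖ * 7 := by
          gcongr
          exact hstep n
      _ = _ := by ring
  obtain ⟨N₀, hN₀⟩ := hA.exists_re_large h (3 * R / 2)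
  obtain ⟨N, hN⟩ := exists_nat_gt N₀
  have hpN : 3 * R / 2 < (g (p N)).re := hN₀ N (by simpa using hN)
  have hp0 : (g (p 0)).re ≤ R / 2 := by simpa [hp] using hA.re_comp_le
  -- Truncation one unit inside the range of the retained indices: as jumps are at most `1`, a step
  -- from a discarded index does not change `m`, so only retained indices contribute to the
  -- telescoping sum.
  set m : ℝ → ℝ := fun x => max (R / 2 + 2) (min x (3 * R / 2 - 2)) with hm
  have hmlip : ∀ x y, m x - m y ≤ |x - y| := by
    intro x y
    refine (le_abs_self _).trans ((abs_max_sub_max_le_max _ _ _ _).trans ?_)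
    rw [sub_self, abs_zero]
    refine max_le (abs_nonneg _) ((abs_min_sub_min_le_max _ _ _ _).trans ?_)
    rw [sub_self, abs_zero]
    exact max_le le_rfl (abs_nonneg _)
  classical
  refine ⟨(Finset.range N).filter fun n => R / 2 + 1 ≤ (g (p n)).re ∧
    (g (p n)).re ≤ 3 * R / 2 - 1, fun n hn => (Finset.mem_filter.1 hn).2, ?_⟩
  have htel : m (g (p N)).re - m (g (p 0)).re ≤ ∑ n ∈ (Finset.range N).filter
      (fun n => R / 2 + 1 ≤ (g (p n)).re ∧ (g (p n)).re ≤ 3 * R / 2 - 1),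
        7 * distortionConst * ‖deriv g (p n)‖ := by
    rw [← Finset.sum_range_sub (fun n => m (g (p n)).re), Finset.sum_filter]
    refine Finset.sum_le_sum fun n _ => ?_
    split_ifs with hn
    · exact (hmlip _ _).trans (hqK n)
    · have h1 := abs_le.1 (hq1 n)
      rw [not_and_or, not_le, not_le] at hn
      simp only [hm]
      rcases hn with hn | hn
      · rw [max_eq_left, max_eq_left, sub_self]
        · exact (min_le_left _ _).trans (by linarith)
        · exact (min_le_left _ _).trans (by linarith)
      · rw [min_eq_right, min_eq_right, sub_self]
        · linarith
        · linarith
  have hmN : m (g (p N)).re = 3 * R / 2 - 2 := by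
    simp only [hm]
    rw [min_eq_right (by linarith), max_eq_right (by linarith)]
  have hm0 : m (g (p 0)).re = R / 2 + 2 := by
    simp only [hm]
    exact max_eq_left ((min_le_left _ _).trans (by linarith))
  rw [hmN, hm0, ← Finset.mul_sum] at htel
  rw [div_le_iff₀ (by positivity)]
  simp only [hp] at htel ⊢
  linarith

/-- At least `R / 10` values of `u` for each retained `s`, times the sum over `s`, give a multiple
of `R ^ 2 * ‖deriv g R‖`. The exponent `18` in `lt_sq_mul` is `17` from the distortion of the
composition plus one from the sum over `s`. -/
theorem one_lt_sum (hA : IsAdmissible g R₀ R) (h : IsTractBranch g F R₀ L) :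
    1 < ∑ p ∈ (hA.finite_goodPairs h).toFinset,
      ‖deriv g R‖ * ‖deriv g (g R + 2 * Real.pi * Complex.I * p.2)‖ /
        (8 * 384 ^ 2 * distortionConst ^ 17) := by
  have hK : 0 < distortionConst := one_pos.trans_le one_le_distortionConst
  have hR := hA.size_le
  obtain ⟨S, hS, hsum⟩ := hA.exists_finset_sum_ge h
  choose U hU hcard using fun n : ℕ =>
    exists_finset_card_ge hR (g (g R + 2 * Real.pi * Complex.I * (n : ℤ))).im
  classical
  set P : Finset (ℤ × ℤ) := (S.sigma U).image fun p => (p.2, (p.1 : ℤ)) with hP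
  have hsub : P ⊆ (hA.finite_goodPairs h).toFinset := by
    intro p hp
    obtain ⟨⟨n, u⟩, hmem, rfl⟩ := Finset.mem_image.1 hp
    obtain ⟨hn, hu⟩ := Finset.mem_sigma.1 hmem
    rw [Finite.mem_toFinset]
    exact hA.mem_goodPairs h (hS n hn).1 (hS n hn).2 (hU n u hu)
  refine lt_of_lt_of_le ?_ (Finset.sum_le_sum_of_subset_of_nonneg hsub fun p _ _ => by positivity)
  rw [hP, Finset.sum_image (by
    rintro ⟨n, u⟩ - ⟨n', u'⟩ - e
    simp only [Prod.mk.injEq, Nat.cast_inj] at e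
    obtain ⟨rfl, rfl⟩ := e
    rfl), Finset.sum_sigma]
  simp only [Finset.sum_const, nsmul_eq_mul]
  have hlt := hA.lt_sq_mul
  set C : ℝ := 8 * 384 ^ 2 * distortionConst ^ 17 with hC
  have hC0 : 0 < C := by positivity
  calc (1 : ℝ) < R / 10 * (‖deriv g R‖ / C * (R / (14 * distortionConst))) := by
        rw [show R / 10 * (‖deriv g R‖ / C * (R / (14 * distortionConst))) =
          R ^ 2 * ‖deriv g R‖ / (10 * 14 * (8 * 384 ^ 2) * distortionConst ^ 18) by
            rw [hC]
            field_simp]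
        rwa [one_lt_div (by positivity)]
    _ ≤ R / 10 * (‖deriv g R‖ / C *
          ∑ n ∈ S, ‖deriv g (g R + 2 * Real.pi * Complex.I * (n : ℤ))‖) := by gcongr
    _ = ∑ n ∈ S, R / 10 * (‖deriv g R‖ * ‖deriv g (g R + 2 * Real.pi * Complex.I * (n : ℤ))‖ / C) := by
        rw [Finset.mul_sum, Finset.mul_sum]
        refine Finset.sum_congr rfl fun n _ => ?_
        ring
    _ ≤ _ := Finset.sum_le_sum fun n _ => by
        gcongr
        exact hcard n

/-- Comparing lower and upper Lipschitz bounds, each summand is at most `1 / 2`; a sum exceeding one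
then needs more than one pair. -/
theorem nontrivial_goodPairs (hA : IsAdmissible g R₀ R) (h : IsTractBranch g F R₀ L) :
    (goodPairs F L R).Nontrivial := by
  have hsum := hA.one_lt_sum h
  have hR := hA.size_le
  have hc : ∀ p : ℤ × ℤ, ‖deriv g R‖ * ‖deriv g (g R + 2 * Real.pi * Complex.I * p.2)‖ /
      (8 * 384 ^ 2 * distortionConst ^ 17) ≤ 1 / 2 := by
    intro p
    have hy : ((R / 2 : ℝ) : ℂ) ∈ square R := by
      rw [mem_square, Complex.ofReal_re, Complex.ofReal_im]
      refine ⟨⟨?_, ?_⟩, ?_, ?_⟩ <;> linarith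
    have h1 := (hA.mul_dist_le h p hA.self_mem hy).trans
      ((hA.lipschitz h p).dist_le_mul _ hA.self_mem _ hy)
    have hpos : 0 < dist (R : ℂ) ((R / 2 : ℝ) : ℂ) := by
      rw [dist_pos]
      intro e
      have := Complex.ofReal_injective e
      linarith
    have := le_of_mul_le_mul_right h1 hpos
    simpa using this
  by_contra hn
  have hcard : (hA.finite_goodPairs h).toFinset.card ≤ 1 := by
    rw [Finset.card_le_one]
    intro a ha b hb
    rw [not_nontrivial_iff] at hn
    exact hn ((hA.finite_goodPairs h).mem_toFinset.1 ha) ((hA.finite_goodPairs h).mem_toFinset.1 hb)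
  have hle := Finset.sum_le_card_nsmul (hA.finite_goodPairs h).toFinset _ _ fun p _ => hc p
  rw [nsmul_eq_mul] at hle
  have : ((hA.finite_goodPairs h).toFinset.card : ℝ) ≤ 1 := by exact_mod_cast hcard
  linarith

theorem isConformalIFS (hA : IsAdmissible g R₀ R) (h : IsTractBranch g F R₀ L) :
    IsConformalIFS (invBranch₂ F L) (goodPairs F L R) (square R) where
  finite := hA.finite_goodPairs h
  nontrivial := hA.nontrivial_goodPairs h
  conformal := by
    intro p _
    set U : Set ℂ := halfPlane R₀ ∩ (fun w => g w + 2 * Real.pi * Complex.I * p.2) ⁻¹' halfPlane R₀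
      with hU
    have hdiff : DifferentiableOn ℂ (fun w => g w + 2 * Real.pi * Complex.I * p.2)
        (halfPlane R₀) := h.conformal.differentiableOn.add_const _
    have heq : EqOn (invBranch₂ F L p) (fun w => g (g w + 2 * Real.pi * Complex.I * p.2) +
        2 * Real.pi * Complex.I * p.1) U := by
      intro w hw
      rw [invBranch₂, Function.comp_apply, h.invBranch_eq hw.1, h.invBranch_eq hw.2]
    refine ⟨U, hdiff.continuousOn.isOpen_inter_preimage (isOpen_halfPlane R₀) (isOpen_halfPlane R₀),
      fun x hx => ⟨hA.square_subset hx, hA.branch_mem h hx p.2⟩, ?_, ?_⟩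
    · refine DifferentiableOn.congr ?_ heq
      exact (h.conformal.differentiableOn.comp (hdiff.mono inter_subset_left)
        fun w hw => hw.2).add_const _
    · intro x hx y hy hxy
      rw [heq hx, heq hy] at hxy
      exact h.conformal.injOn hx.1 hy.1
        (add_right_cancel (h.conformal.injOn hx.2 hy.2 (add_right_cancel hxy)))
  mapsTo := fun p hp x hx => hp (mem_image_of_mem _ hx)
  contracting := ⟨1 / 2, by
    rw [← NNReal.coe_lt_coe]
    norm_num, fun p _ => hA.lipschitz h p⟩
  -- A point of the image determines its pair: it lies in `L u`, its image under `F` lies in `L s`,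
  -- and the lifted tracts are pairwise disjoint.
  disjoint := by
    intro p _ p' _ hne
    refine disjoint_left.2 ?_
    rintro _ ⟨x, hx, rfl⟩ ⟨y, hy, hxy⟩
    have h1 := hA.invBranch₂_mem h hy p'
    rw [hxy] at h1
    have h2 := congrArg F hxy
    rw [hA.apply_invBranch₂ h hx, hA.apply_invBranch₂ h hy] at h2
    have h3 := h.add_mem (h.conformal.mapsTo (hA.square_subset hy)) p'.2
    rw [h2] at h3
    exact hne (Prod.ext (h.eq_of_mem (hA.invBranch₂_mem h hx p) h1)
      (h.eq_of_mem (h.add_mem (h.conformal.mapsTo (hA.square_subset hx)) p.2) h3))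

theorem one_lt_dimH (hA : IsAdmissible g R₀ R) (h : IsTractBranch g F R₀ L) :
    1 < dimH (limitSet (invBranch₂ F L) (goodPairs F L R) (square R)) := by
  have hK : 0 < distortionConst := one_pos.trans_le one_le_distortionConst
  refine (hA.isConformalIFS h).one_lt_dimH_limitSet (isCompact_square R) ⟨_, hA.self_mem⟩
    (c := fun p => ‖deriv g R‖ * ‖deriv g (g R + 2 * Real.pi * Complex.I * p.2)‖ /
      (8 * 384 ^ 2 * distortionConst ^ 17)) (fun p _ => ?_)
    (fun p _ x hx y hy => hA.mul_dist_le h p hx hy) (hA.one_lt_sum h)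
  have h1 := h.conformal.norm_deriv_pos (hA.square_subset hA.self_mem)
  have h2 := h.conformal.norm_deriv_pos (hA.branch_mem h hA.self_mem p.2)
  positivity

end IsAdmissible

/-! ### Expansion along orbits and conclusion -/

theorem tendsto_norm_deriv_iterate {F : ℂ → ℂ} {z : ℂ}
    (h : ∀ n, DifferentiableAt ℂ F (F^[n] z) ∧ 2 ≤ ‖deriv F (F^[n] z)‖) :
    Tendsto (fun n : ℕ => ‖deriv (F^[n]) z‖) atTop atTop := by
  have key : ∀ n : ℕ, DifferentiableAt ℂ (F^[n]) z ∧ 2 ^ n ≤ ‖deriv (F^[n]) z‖ := by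
    intro n
    induction n with
    | zero => simp
    | succ n ih =>
      have hd := (h n).1.hasDerivAt.comp z ih.1.hasDerivAt
      rw [← Function.iterate_succ'] at hd
      refine ⟨hd.differentiableAt, ?_⟩
      rw [hd.deriv, norm_mul, pow_succ, mul_comm]
      exact mul_le_mul (h n).2 ih.2 (by positivity) (norm_nonneg _)
  exact tendsto_atTop_mono (fun n => (key n).2) (tendsto_pow_atTop_atTop_of_one_lt one_lt_two)

end LogTract

theorem proposition1 (f : ℂ → ℂ) (T : Set ℂ) (R₀ : ℝ)
    (hT : LogTract.IsLogarithmicTract f T R₀) (h0 : (0 : ℂ) ∉ closure T)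
    (L : ℤ → Set ℂ) (F : ℂ → ℂ) (hF : LogTract.IsLogCoordinates f T L F) :
    -- `F` maps each `L s` bijectively onto the half-plane, so the inverse branches are genuine
    (∀ s : ℤ, BijOn F (L s) (LogTract.halfPlane R₀)) ∧
    ∀ M : ℝ, ∃ R : ℝ, M < R ∧
      -- the compositions `F_u⁻¹ ∘ F_s⁻¹` are defined on the square
      LogTract.square R ⊆ LogTract.halfPlane R₀ ∧
      (∀ s : ℤ, LogTract.invBranch F L s '' LogTract.square R ⊆ LogTract.halfPlane R₀) ∧
      LogTract.IsConformalIFS (LogTract.invBranch₂ F L) (LogTract.goodPairs F L R)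
        (LogTract.square R) ∧
      ∃ J : Set ℂ,
        J = LogTract.limitSet (LogTract.invBranch₂ F L) (LogTract.goodPairs F L R)
          (LogTract.square R) ∧
        LogTract.IsCantorSet J ∧
        J ⊆ ⋃ s, L s ∧
        1 < dimH J ∧
        F '' J ⊆ ⋃ s, L s ∧
        F^[2] '' J = J ∧
        (∀ z ∈ J, (∀ n : ℕ, F^[n] z ∈ ⋃ s, L s) ∧
          Bornology.IsBounded (range fun n : ℕ => F^[n] z)) ∧
        (∀ z ∈ J, Tendsto (fun n : ℕ => ‖deriv (F^[n]) z‖) atTop atTop) := by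
  obtain ⟨g, h⟩ := hF.exists_isTractBranch hT fun h => h0 (subset_closure h)
  refine ⟨h.bijOn, fun M => ?_⟩
  obtain ⟨R, hMR, hA⟩ := h.exists_isAdmissible M
  have hifs := hA.isConformalIFS h
  have hQc := LogTract.isCompact_square R
  have hQne : (LogTract.square R).Nonempty := ⟨_, hA.self_mem⟩
  have hcantor := hifs.isCantorSet_limitSet hQc hQne
  refine ⟨R, hMR, hA.square_subset, ?_, hifs, _, rfl, hcantor, ?_⟩
  · rintro s _ ⟨x, hx, rfl⟩
    rw [h.invBranch_eq (hA.square_subset hx)]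
    exact hA.branch_mem h hx s
  set J := LogTract.limitSet (LogTract.invBranch₂ F L) (LogTract.goodPairs F L R)
    (LogTract.square R) with hJ
  have hJQ : J ⊆ LogTract.square R := LogTract.limitSet_subset
  have hJimg : ∀ z ∈ J, ∃ p ∈ LogTract.goodPairs F L R, ∃ x ∈ J,
      LogTract.invBranch₂ F L p x = z := by
    intro z hz
    rw [hJ, ← hifs.biUnion_image_limitSet] at hz
    obtain ⟨p, hp, x, hx, rfl⟩ := Set.mem_iUnion₂.1 hz
    exact ⟨p, hp, x, hx, rfl⟩
  have hJL : J ⊆ ⋃ s, L s := by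
    intro z hz
    obtain ⟨p, -, x, hx, rfl⟩ := hJimg z hz
    exact mem_iUnion_of_mem p.1 (hA.invBranch₂_mem h (hJQ hx) p)
  have hFJ : ∀ z ∈ J, F z ∈ ⋃ s, L s ∧ Real.log R₀ + 10 ^ 6 ≤ (F z).re ∧ F (F z) ∈ J := by
    intro z hz
    obtain ⟨p, -, x, hx, rfl⟩ := hJimg z hz
    rw [hA.apply_apply_invBranch₂ h (hJQ hx), hA.apply_invBranch₂ h (hJQ hx)]
    exact ⟨mem_iUnion_of_mem p.2 (h.add_mem (h.conformal.mapsTo (hA.square_subset (hJQ hx))) p.2),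
      hA.le_re_branch h (hJQ hx) p.2, hx⟩
  -- Orbits alternate between the limit set and its image under `F`; both are compact and lie in the
  -- lifted tracts.
  have horbit : ∀ z ∈ J, ∀ n : ℕ, F^[n] z ∈ J ∪ F '' J := by
    intro z hz n
    induction n with
    | zero => exact Or.inl hz
    | succ n ih =>
      rw [Function.iterate_succ_apply']
      rcases ih with hn | ⟨y, hy, hyn⟩
      · exact Or.inr ⟨_, hn, rfl⟩
      · rw [← hyn]
        exact Or.inl (hFJ y hy).2.2
  have hsub : J ∪ F '' J ⊆ ⋃ s, L s := by
    rintro z (hz | ⟨y, hy, rfl⟩)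
    exacts [hJL hz, (hFJ y hy).1]
  have hexpand : ∀ z ∈ J ∪ F '' J, DifferentiableAt ℂ F z ∧ 2 ≤ ‖deriv F z‖ := by
    intro z hz
    refine h.two_le_norm_deriv (hsub hz) ?_
    rcases hz with hz | ⟨y, hy, rfl⟩
    · linarith [(hFJ z hz).2.1]
    -- Here `F z` is back in the square, so its real part exceeds `log R₀` by at least `R / 4 ≥
    -- 1000`, more than the `768` needed for expansion by `2`.
    · linarith [hA.le_re_of_mem (hJQ (hFJ y hy).2.2), hA.size_le]
  refine ⟨hJL, hA.one_lt_dimH h, fun z hz => hsub (Or.inr hz), ?_, fun z hz => ⟨fun n =>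
    hsub (horbit z hz n), ?_⟩, fun z hz =>
      LogTract.tendsto_norm_deriv_iterate fun n => hexpand _ (horbit z hz n)⟩
  · apply Subset.antisymm
    · rintro _ ⟨z, hz, rfl⟩
      exact (hFJ z hz).2.2
    · intro x hx
      obtain ⟨p, hp⟩ := hifs.nontrivial.nonempty
      refine ⟨LogTract.invBranch₂ F L p x, ?_, hA.apply_apply_invBranch₂ h (hJQ hx) p⟩
      rw [hJ, ← hifs.biUnion_image_limitSet]
      exact mem_biUnion hp ⟨x, hx, rfl⟩
  · refine (hcantor.isCompact.union (hcantor.isCompact.image_of_continuousOn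
      (hF.continuousOn.mono hJL))).isBounded.subset ?_
    rintro _ ⟨n, rfl⟩
    exact horbit z hz n
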